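/- Let $(\Omega,\mathcal F,P)$ be a probability space, let $d\ge 1$ be an integer, and let $\mathcal G$ be a real vector space of random variables on $\Omega$, each of which is Gaussian (not necessarily centred, possibly degenerate). Let $\overline{\Pi}^d_{\mathcal G}(\mathbb R)$ be the closure, with respect to convergence in probability, of the set of random variables $q(Z_1,\dots,Z_n)$ with $n\ge 1$, $Z_1,\dots,Z_n\in\mathcal G$ and $q:\mathbb R^n\to\mathbb R$ a polynomial of degree at most $d$. Let $F$ be a locally convex Hausdorff real topological vector space with dual $F^*$, and assume that $F$ is metrizable or strongly Lindelöf (every open cover of every subset of $F$ has a countable subcover). Let $X:\Omega\to F$ be a Borel measurable random element that is a.s. separably valued, i.e. $P(X\in A)=1$ for some separable closed set $A\subseteq F$, and suppose that $x^*(X)\in\overline{\Pi}^d_{\mathcal G}(\mathbb R)$ for all $x^*\in F^*$. Let $N:F\to[0,\infty]$ be a lower semicontinuous pseudo-seminorm, i.e. $N(\lambda x)=|\lambda|N(x)$ (with $0\cdot\infty=0$) and $N(x+y)\le N(x)+N(y)$ for all $x,y\in F$, $\lambda\in\mathbb R$, and suppose that $N(X)<\infty$ a.s. Write $\|N(X)\|_p=E[N(X)^p]^{1/p}$.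 Then for all real $1<p<r$, $$\|N(X)\|_r\le 2^{d^2/2+d}\left(\frac{r-1}{p-1}\right)^{d/2}\|N(X)\|_p<\infty,$$ and $$E\big[e^{\varepsilon N(X)^{2/d}}\big]<\infty\qquad\text{for all real }\varepsilon<\frac{d}{e\,2^{d+5}\,\|N(X)\|_2^{2/d}},$$ where the right-hand side is read as $+\infty$ if $\|N(X)\|_2=0$. -/

import Mathlib

open MeasureTheory ProbabilityTheory Filter TopologicalSpace
open scoped ENNReal Topology

namespace GaussianChaos

/-- A pseudo-seminorm on a real vector space: a map into `[0, ∞]` that is absolutely homogeneous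
(with the convention `0 * ∞ = 0`, so that `N 0 = 0`) and subadditive. -/
structure IsPseudoSeminorm {F : Type*} [AddCommGroup F] [Module ℝ F] (N : F → ℝ≥0∞) : Prop where
  smul : ∀ (c : ℝ) (x : F), N (c • x) = ENNReal.ofReal |c| * N x
  add_le : ∀ x y : F, N (x + y) ≤ N x + N y

/-- `X` is a.s. separably valued: it lies a.s. in some closed subset that is separable in its
subspace topology. -/
def AESeparablyValued {Ω F : Type*} [MeasurableSpace Ω] [TopologicalSpace F]
    (P : Measure Ω) (X : Ω → F) : Prop :=
  ∃ A : Set F, IsClosed A ∧ SeparableSpace A ∧ ∀ᵐ ω ∂P, X ω ∈ A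

/-- `𝒢`, a real vector space of functions on `Ω`, consists of Gaussian random variables
(not necessarily centred; constants are degenerate Gaussian variables). -/
def IsGaussianSpace {Ω : Type*} [MeasurableSpace Ω] (P : Measure Ω)
    (𝒢 : Submodule ℝ (Ω → ℝ)) : Prop :=
  ∀ Z ∈ 𝒢, HasGaussianLaw Z P

/-- The random variables `q(Z₁, …, Zₙ)` with `Z₁, …, Zₙ ∈ 𝒢` and `q` a real polynomial of total
degree at most `d` (not necessarily tetrahedral). -/
def gaussianPolynomials {Ω : Type*} (𝒢 : Submodule ℝ (Ω → ℝ)) (d : ℕ) : Set (Ω → ℝ) :=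
  {Y | ∃ (n : ℕ) (Z : Fin n → Ω → ℝ) (q : MvPolynomial (Fin n) ℝ),
    (∀ i, Z i ∈ 𝒢) ∧ q.totalDegree ≤ d ∧ Y = fun ω => MvPolynomial.eval (fun i => Z i ω) q}

/-- The closure in probability of the Gaussian polynomials of degree at most `d`. Convergence in
probability is metrizable, so limits of sequences suffice. -/
def gaussianChaos {Ω : Type*} [MeasurableSpace Ω] (P : Measure Ω)
    (𝒢 : Submodule ℝ (Ω → ℝ)) (d : ℕ) : Set (Ω → ℝ) :=
  {Y | ∃ Q : ℕ → Ω → ℝ, (∀ k, Q k ∈ gaussianPolynomials 𝒢 d) ∧ TendstoInMeasure P Q atTop Y}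

end GaussianChaos

/-!
For polynomials in a Gaussian vector the comparison is Gaussian hypercontractivity combined with
extrapolation: the Ornstein–Uhlenbeck average with correlation `t` of a polynomial of degree at most
`d` is a polynomial of degree at most `d` in `t`, so its value at `t = 1` is a combination of its
values at `d + 1` equally spaced correlations `t ≤ √((p - 1) / (r - 1))`, for which the average is
a contraction from `L^p` to `L^r`. The averages are positive operators, hence the same bound holds
for suprema of polynomials. Hypercontractivity in its two-function form reduces to two correlated
signs, where it is a second-order Taylor expansion; the central limit theorem carries it to
correlated Gaussians, and it tensorizes.

By a Hahn–Banach and Lindelöf argument `N` agrees almost surely along `X` with a supremum of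
countably many `|φ n|`, `φ n ∈ F*`. The approximation in probability costs nothing: comparable
moments force tightness of the second moments (Paley–Zygmund), so the comparison survives the limit.
Finally the exponential moments follow by summing the moments of order `2 k / d`.
-/

namespace GaussianChaos

section SignPair

lemma exists_one_add_rpow_le (a : ℝ) : ∃ C : ℝ, 0 ≤ C ∧ ∀ᶠ s : ℝ in 𝓝 0,
    (1 + s) ^ a ≤ 1 + a * s - a * (1 - a) / 2 * s ^ 2 + C * |s| ^ 3 := by
  obtain ⟨C, hC0, hC⟩ :=
    ((Real.one_add_rpow_hasFPowerSeriesAt_zero (a := a)).isBigO_sub_partialSum_pow 3).exists_nonneg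
  have hchoose : Ring.choose a 2 = a * (a - 1) / 2 := by
    have h := Ring.descPochhammer_eq_factorial_smul_choose a 2
    simp [descPochhammer_succ_right, Polynomial.smeval_X_mul, Polynomial.smeval_sub,
      Polynomial.smeval_X, Polynomial.smeval_one] at h
    linarith
  have hsum (s : ℝ) : (binomialSeries ℝ a).partialSum 3 s =
      1 + a * s + a * (a - 1) / 2 * s ^ 2 := by
    simp [-FormalMultilinearSeries.apply_eq_prod_smul_coeff, FormalMultilinearSeries.partialSum,
      Finset.sum_range_succ, hchoose]
  refine ⟨C, hC0, hC.bound.mono fun s hs => ?_⟩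
  have hs' := (le_abs_self _).trans hs
  simp only [zero_add, hsum, norm_pow, Real.norm_eq_abs, abs_abs] at hs'
  linarith

lemma quadratic_form_nonneg {a b ρ : ℝ} (ha : 0 < a) (ha1 : a < 1) (hb : 0 < b)
    (hρ : a * b * ρ ^ 2 ≤ (1 - a) * (1 - b)) (α β : ℝ) :
    0 ≤ a * (1 - a) / 2 * α ^ 2 + b * (1 - b) / 2 * β ^ 2 - ρ * (a * α * (b * β)) := by
  refine nonneg_of_mul_nonneg_right (a := 2 * (a * (1 - a))) ?_
    (mul_pos two_pos (mul_pos ha (sub_pos.2 ha1)))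
  calc 0 ≤ (a * (1 - a) * α - a * b * ρ * β) ^ 2 +
        a * b * ((1 - a) * (1 - b) - a * b * ρ ^ 2) * β ^ 2 :=
        add_nonneg (sq_nonneg _)
          (mul_nonneg (mul_nonneg (mul_pos ha hb).le (sub_nonneg.2 hρ)) (sq_nonneg β))
    _ = _ := by ring

/-- The mean of `φ (ε, δ)` over two signs with correlation `E[ε δ] = ρ`. -/
noncomputable def signMean {V : Type*} [AddCommGroup V] [Module ℝ V] (ρ : ℝ) (φ : ℝ → ℝ → V) : V :=
  ((1 + ρ) / 4) • (φ 1 1 + φ (-1) (-1)) + ((1 - ρ) / 4) • (φ 1 (-1) + φ (-1) 1)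

lemma signMean_affine_mul_affine (ρ p₀ p₁ q₀ q₁ : ℝ) :
    signMean ρ (fun ε δ => (p₀ + p₁ * ε) * (q₀ + q₁ * δ)) = p₀ * q₀ + ρ * (p₁ * q₁) := by
  simp only [signMean, smul_eq_mul]
  ring

lemma signMean_mono {ρ : ℝ} (hρ : |ρ| ≤ 1) {φ ψ : ℝ → ℝ → ℝ}
    (h : ∀ ε δ : ℝ, |ε| = 1 → |δ| = 1 → φ ε δ ≤ ψ ε δ) : signMean ρ φ ≤ signMean ρ ψ := by
  refine add_le_add (mul_le_mul_of_nonneg_left (add_le_add ?_ ?_) ?_)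
    (mul_le_mul_of_nonneg_left (add_le_add ?_ ?_) ?_)
  case refine_3 => linarith [neg_le_of_abs_le hρ]
  case refine_6 => linarith [le_of_abs_le hρ]
  all_goals exact h _ _ (by simp) (by simp)

lemma abs_mul_sign {α ε : ℝ} (hε : |ε| = 1) : |α * ε| = |α| := by
  rw [abs_mul, hε, mul_one]

lemma exists_one_add_mul_sign_rpow_le (a : ℝ) : ∃ C : ℝ, 0 ≤ C ∧ ∀ᶠ τ : ℝ in 𝓝[>] 0,
    ∀ α ε : ℝ, |α| ≤ τ → |ε| = 1 →
      (1 + α * ε) ^ a ≤ 1 - a * (1 - a) / 2 * α ^ 2 + C * τ ^ 3 + a * α * ε := by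
  obtain ⟨C, hC0, hC⟩ := exists_one_add_rpow_le a
  obtain ⟨η, hη, hball⟩ := Metric.eventually_nhds_iff.1 hC
  refine ⟨C, hC0, ?_⟩
  filter_upwards [Ioo_mem_nhdsGT hη] with τ hτ α ε hα hε
  have hs : |α * ε| ≤ τ := (abs_mul_sign hε).trans_le hα
  have hsq : (α * ε) ^ 2 = α ^ 2 := by rw [← sq_abs, abs_mul_sign hε, sq_abs]
  have hbound := hball (y := α * ε) (by simpa using hs.trans_lt hτ.2)
  have hcube : C * |α * ε| ^ 3 ≤ C * τ ^ 3 := by gcongr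
  rw [hsq] at hbound
  linarith

lemma quadratic_mul_quadratic_le {A B c c' τ x y : ℝ} (hA : 0 ≤ A) (hB : 0 ≤ B) (hc : 0 ≤ c)
    (hc' : 0 ≤ c') (hτ0 : 0 ≤ τ) (hτ1 : τ ≤ 1) (hx : |x| ≤ τ) (hy : |y| ≤ τ) :
    (1 - c * x ^ 2 + A * τ ^ 3) * (1 - c' * y ^ 2 + B * τ ^ 3) ≤
      1 - c * x ^ 2 - c' * y ^ 2 + (A + B + (c * c' + A * B)) * τ ^ 3 := by
  have hpow {k : ℕ} (hk : 3 ≤ k) : τ ^ k ≤ τ ^ 3 := pow_le_pow_of_le_one hτ0 hτ1 hk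
  have hquartic : c * c' * (x ^ 2 * y ^ 2) ≤ c * c' * τ ^ 3 := by
    refine mul_le_mul_of_nonneg_left ?_ (mul_nonneg hc hc')
    calc x ^ 2 * y ^ 2 ≤ τ ^ 2 * τ ^ 2 := by
          rw [← sq_abs x, ← sq_abs y]
          gcongr
      _ = τ ^ 4 := by ring
      _ ≤ τ ^ 3 := hpow (by norm_num)
  have hsextic : A * B * τ ^ 6 ≤ A * B * τ ^ 3 :=
    mul_le_mul_of_nonneg_left (hpow (by norm_num)) (mul_nonneg hA hB)
  have hmixed : 0 ≤ c * x ^ 2 * (B * τ ^ 3) + A * τ ^ 3 * (c' * y ^ 2) := by positivity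
  linarith

/-- The second-order terms form a nonpositive quadratic form, so only a cubic error remains. -/
lemma exists_signMean_rpow_le {a b ρ : ℝ} (ha : 0 < a) (ha1 : a < 1) (hb : 0 < b) (hb1 : b < 1)
    (hρ1 : |ρ| ≤ 1) (hρ : a * b * ρ ^ 2 ≤ (1 - a) * (1 - b)) :
    ∃ C : ℝ, 0 ≤ C ∧ ∀ᶠ τ : ℝ in 𝓝[>] 0, ∀ α β : ℝ, |α| ≤ τ → |β| ≤ τ →
      signMean ρ (fun ε δ => (1 + α * ε) ^ a * (1 + β * δ) ^ b) ≤ 1 + C * τ ^ 3 := by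
  have hc : 0 ≤ a * (1 - a) / 2 := div_nonneg (mul_nonneg ha.le (sub_pos.2 ha1).le) zero_le_two
  have hc' : 0 ≤ b * (1 - b) / 2 := div_nonneg (mul_nonneg hb.le (sub_pos.2 hb1).le) zero_le_two
  obtain ⟨A, hA0, hA⟩ := exists_one_add_mul_sign_rpow_le a
  obtain ⟨B, hB0, hB⟩ := exists_one_add_mul_sign_rpow_le b
  refine ⟨A + B + (a * (1 - a) / 2 * (b * (1 - b) / 2) + A * B), by positivity, ?_⟩
  filter_upwards [hA, hB, Ioo_mem_nhdsGT one_pos] with τ hAτ hBτ ⟨hτ0, hτ1⟩ α β hα hβ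
  have hbase {x ε : ℝ} (hx : |x| ≤ τ) (hε : |ε| = 1) : 0 ≤ 1 + x * ε := by
    linarith [neg_abs_le (x * ε), abs_mul_sign (α := x) hε]
  calc signMean ρ (fun ε δ => (1 + α * ε) ^ a * (1 + β * δ) ^ b)
      ≤ signMean ρ (fun ε δ => (1 - a * (1 - a) / 2 * α ^ 2 + A * τ ^ 3 + a * α * ε) *
          (1 - b * (1 - b) / 2 * β ^ 2 + B * τ ^ 3 + b * β * δ)) := by
        refine signMean_mono hρ1 fun ε δ hε hδ => ?_
        have hA' := hAτ α ε hα hε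
        exact mul_le_mul hA' (hBτ β δ hβ hδ) (Real.rpow_nonneg (hbase hβ hδ) b)
          ((Real.rpow_nonneg (hbase hα hε) a).trans hA')
    _ = (1 - a * (1 - a) / 2 * α ^ 2 + A * τ ^ 3) * (1 - b * (1 - b) / 2 * β ^ 2 + B * τ ^ 3) +
          ρ * (a * α * (b * β)) := signMean_affine_mul_affine ..
    _ ≤ 1 + (A + B + (a * (1 - a) / 2 * (b * (1 - b) / 2) + A * B)) * τ ^ 3 := by
        linarith [quadratic_form_nonneg ha ha1 hb hρ α β,
          quadratic_mul_quadratic_le hA0 hB0 hc hc' hτ0.le hτ1.le hα hβ]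

end SignPair

section Convolution

/-- The law of `(σ ε, σ δ)`, where `ε` and `δ` are signs with correlation `ρ`. -/
noncomputable def signPair (ρ σ : ℝ) : Measure (EuclideanSpace ℝ (Fin 2)) :=
  ENNReal.ofReal ((1 + ρ) / 4) • (Measure.dirac !₂[σ, σ] + Measure.dirac !₂[-σ, -σ]) +
    ENNReal.ofReal ((1 - ρ) / 4) • (Measure.dirac !₂[σ, -σ] + Measure.dirac !₂[-σ, σ])

lemma integral_signPair {V : Type*} [NormedAddCommGroup V] [NormedSpace ℝ V] [CompleteSpace V]
    {ρ : ℝ} (hρ : |ρ| ≤ 1) (σ : ℝ) (φ : EuclideanSpace ℝ (Fin 2) → V) :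
    ∫ w, φ w ∂signPair ρ σ = signMean ρ fun ε δ => φ !₂[σ * ε, σ * δ] := by
  have hplus : 0 ≤ (1 + ρ) / 4 := by linarith [neg_le_of_abs_le hρ]
  have hminus : 0 ≤ (1 - ρ) / 4 := by linarith [le_of_abs_le hρ]
  have hdirac (x) : Integrable φ (Measure.dirac x) := integrable_dirac enorm_lt_top
  have hsum (x y) : Integrable φ (Measure.dirac x + Measure.dirac y) :=
    (hdirac x).add_measure (hdirac y)
  rw [signPair, integral_add_measure ((hsum _ _).smul_measure ENNReal.ofReal_ne_top)
    ((hsum _ _).smul_measure ENNReal.ofReal_ne_top), integral_smul_measure, integral_smul_measure,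
    integral_add_measure (hdirac _) (hdirac _), integral_add_measure (hdirac _) (hdirac _),
    ENNReal.toReal_ofReal hplus, ENNReal.toReal_ofReal hminus]
  simp only [signMean, integral_dirac, mul_one, mul_neg]

lemma integral_signPair_coord {ρ : ℝ} (hρ : |ρ| ≤ 1) (σ : ℝ) (f : ℝ → ℝ) (i : Fin 2) :
    ∫ w, f (w i) ∂signPair ρ σ = (f σ + f (-σ)) / 2 := by
  rw [integral_signPair hρ]
  fin_cases i <;> simp [signMean] <;> ring

lemma isProbabilityMeasure_signPair {ρ : ℝ} (hρ : |ρ| ≤ 1) (σ : ℝ) :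
    IsProbabilityMeasure (signPair ρ σ) := by
  have hplus : 0 ≤ (1 + ρ) / 4 := by linarith [neg_le_of_abs_le hρ]
  have hminus : 0 ≤ (1 - ρ) / 4 := by linarith [le_of_abs_le hρ]
  constructor
  simp only [signPair, Measure.coe_add, Measure.coe_smul, Pi.add_apply, Pi.smul_apply,
    measure_univ, smul_eq_mul, one_add_one_eq_two]
  rw [← add_mul, ← ENNReal.ofReal_add hplus hminus, ← ENNReal.ofReal_ofNat, ← ENNReal.ofReal_mul,
    ENNReal.ofReal_eq_one]
  all_goals linarith

/-- The `n`-th convolution power of a measure. -/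
noncomputable def convPow {M : Type*} [AddMonoid M] [MeasurableSpace M] (μ : Measure M) :
    ℕ → Measure M
  | 0 => Measure.dirac 0
  | n + 1 => convPow μ n ∗ μ

instance {M : Type*} [AddMonoid M] [MeasurableSpace M] [MeasurableAdd₂ M] (μ : Measure M)
    [IsProbabilityMeasure μ] (n : ℕ) : IsProbabilityMeasure (convPow μ n) := by
  induction n with
  | zero => exact Measure.dirac.isProbabilityMeasure
  | succ n ih => exact Measure.probabilitymeasure_of_probabilitymeasures_conv _ _

lemma charFun_convPow {E : Type*} [NormedAddCommGroup E] [InnerProductSpace ℝ E]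
    [MeasurableSpace E] [BorelSpace E] [SecondCountableTopology E]
    (μ : Measure E) [IsProbabilityMeasure μ] (n : ℕ) (t : E) :
    charFun (convPow μ n) t = charFun μ t ^ n := by
  induction n with
  | zero => simp [convPow]
  | succ n ih => rw [convPow, charFun_conv, ih, pow_succ]

variable {a b m M K : ℝ} {L : NNReal} {f g : ℝ → ℝ}

/-- The two-function inequality up to the factor `K`, tested on `L`-Lipschitz functions with values
in `[m, M]`. This class of functions is stable under averaging over translations, which makes the
inequality stable under convolution. -/
def LipschitzTwoFunctionBound (a b m M : ℝ) (L : NNReal) (K : ℝ)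
    (μ : Measure (EuclideanSpace ℝ (Fin 2))) : Prop :=
  ∀ f g : ℝ → ℝ, LipschitzWith L f → LipschitzWith L g →
    (∀ x, f x ∈ Set.Icc m M) → (∀ x, g x ∈ Set.Icc m M) →
    ∫ w, f (w 0) ^ a * g (w 1) ^ b ∂μ ≤ K * ((∫ w, f (w 0) ∂μ) ^ a * (∫ w, g (w 1) ∂μ) ^ b)

lemma norm_rpow_mul_rpow_le {x y : ℝ} (hm : 0 ≤ m) (ha : 0 ≤ a) (hb : 0 ≤ b)
    (hx : x ∈ Set.Icc m M) (hy : y ∈ Set.Icc m M) : ‖x ^ a * y ^ b‖ ≤ M ^ a * M ^ b := by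
  have hrpow {c x : ℝ} (hc : 0 ≤ c) (hx : x ∈ Set.Icc m M) : ‖x ^ c‖ ≤ M ^ c := by
    rw [Real.norm_of_nonneg (Real.rpow_nonneg (hm.trans hx.1) c)]
    exact Real.rpow_le_rpow (hm.trans hx.1) hx.2 hc
  rw [norm_mul]
  exact mul_le_mul (hrpow ha hx) (hrpow hb hy) (norm_nonneg _) ((norm_nonneg _).trans (hrpow ha hx))

section Averages

variable {Ω : Type*} [MeasurableSpace Ω] {μ : Measure Ω} [IsProbabilityMeasure μ] {Y : Ω → ℝ}

lemma integrable_comp_of_mem_Icc (hY : Measurable Y) (hf : Continuous f)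
    (hfb : ∀ x, f x ∈ Set.Icc m M) : Integrable (fun ω => f (Y ω)) μ :=
  .of_mem_Icc m M (hf.measurable.comp hY).aemeasurable (ae_of_all _ fun ω => hfb (Y ω))

lemma integral_mem_Icc (hY : Measurable Y) (hf : Continuous f) (hfb : ∀ x, f x ∈ Set.Icc m M) :
    ∫ ω, f (Y ω) ∂μ ∈ Set.Icc m M := by
  have hinteg := integrable_comp_of_mem_Icc (μ := μ) hY hf hfb
  constructor
  · simpa using integral_mono (integrable_const m) hinteg fun ω => (hfb (Y ω)).1
  · simpa using integral_mono hinteg (integrable_const M) fun ω => (hfb (Y ω)).2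

lemma integrable_rpow_mul_rpow {Z : Ω → ℝ} (hY : Measurable Y) (hZ : Measurable Z) (hm : 0 ≤ m)
    (ha : 0 ≤ a) (hb : 0 ≤ b) (hf : Continuous f) (hg : Continuous g)
    (hfb : ∀ x, f x ∈ Set.Icc m M) (hgb : ∀ x, g x ∈ Set.Icc m M) :
    Integrable (fun ω => f (Y ω) ^ a * g (Z ω) ^ b) μ :=
  .of_bound (((hf.measurable.comp hY).pow_const a).mul
    ((hg.measurable.comp hZ).pow_const b)).aestronglyMeasurable (M ^ a * M ^ b)
    (ae_of_all _ fun _ => norm_rpow_mul_rpow_le hm ha hb (hfb _) (hgb _))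

lemma lipschitzWith_integral_translate (hY : Measurable Y) (hf : LipschitzWith L f)
    (hfb : ∀ x, f x ∈ Set.Icc m M) : LipschitzWith L fun x => ∫ ω, f (x + Y ω) ∂μ := by
  have hinteg (x : ℝ) : Integrable (fun ω => f (x + Y ω)) μ :=
    integrable_comp_of_mem_Icc (hY.const_add x) hf.continuous hfb
  refine .of_dist_le_mul fun x y => ?_
  rw [dist_eq_norm, ← integral_sub (hinteg x) (hinteg y)]
  refine (norm_integral_le_of_norm_le_const (C := L * dist x y) (ae_of_all _ fun ω => ?_)).trans ?_
  · simpa [dist_eq_norm] using hf.dist_le_mul (x + Y ω) (y + Y ω)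
  · simp

end Averages

lemma LipschitzTwoFunctionBound.conv {μ ν : Measure (EuclideanSpace ℝ (Fin 2))} {K' : ℝ}
    [IsProbabilityMeasure μ] [IsProbabilityMeasure ν] (hm : 0 ≤ m) (ha : 0 ≤ a) (hb : 0 ≤ b)
    (hK' : 0 ≤ K') (hμ : LipschitzTwoFunctionBound a b m M L K μ)
    (hν : LipschitzTwoFunctionBound a b m M L K' ν) :
    LipschitzTwoFunctionBound a b m M L (K' * K) (μ ∗ ν) := by
  intro f g hf hg hfb hgb
  have hcoord (i : Fin 2) : Measurable fun w : EuclideanSpace ℝ (Fin 2) => w i := by fun_prop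
  set f' : ℝ → ℝ := fun x => ∫ v, f (x + v 0) ∂ν
  set g' : ℝ → ℝ := fun x => ∫ v, g (x + v 1) ∂ν
  have hf' : LipschitzWith L f' := lipschitzWith_integral_translate (hcoord 0) hf hfb
  have hg' : LipschitzWith L g' := lipschitzWith_integral_translate (hcoord 1) hg hgb
  have hfb' (x : ℝ) : f' x ∈ Set.Icc m M :=
    integral_mem_Icc ((hcoord 0).const_add x) hf.continuous hfb
  have hgb' (x : ℝ) : g' x ∈ Set.Icc m M :=
    integral_mem_Icc ((hcoord 1).const_add x) hg.continuous hgb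
  rw [integral_conv (integrable_comp_of_mem_Icc (hcoord 0) hf.continuous hfb),
    integral_conv (integrable_comp_of_mem_Icc (hcoord 1) hg.continuous hgb), integral_conv
    (integrable_rpow_mul_rpow (hcoord 0) (hcoord 1) hm ha hb hf.continuous hg.continuous hfb hgb)]
  calc ∫ w, ∫ v, f (w 0 + v 0) ^ a * g (w 1 + v 1) ^ b ∂ν ∂μ
      ≤ ∫ w, K' * (f' (w 0) ^ a * g' (w 1) ^ b) ∂μ := by
        refine integral_mono_of_nonneg (ae_of_all _ fun w => integral_nonneg fun v => ?_)
          ((integrable_rpow_mul_rpow (hcoord 0) (hcoord 1) hm ha hb hf'.continuous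
            hg'.continuous hfb' hgb').const_mul K') (ae_of_all _ fun w => ?_)
        · exact mul_nonneg (Real.rpow_nonneg (hm.trans (hfb _).1) a)
            (Real.rpow_nonneg (hm.trans (hgb _).1) b)
        · exact hν (fun x => f (w 0 + x)) (fun x => g (w 1 + x))
            (by simpa [Function.comp_def] using
              hf.comp (isometry_add_left _).lipschitz)
            (by simpa [Function.comp_def] using
              hg.comp (isometry_add_left _).lipschitz)
            (fun _ => hfb _) (fun _ => hgb _)
    _ = K' * ∫ w, f' (w 0) ^ a * g' (w 1) ^ b ∂μ := integral_const_mul ..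
    _ ≤ K' * (K * ((∫ w, f' (w 0) ∂μ) ^ a * (∫ w, g' (w 1) ∂μ) ^ b)) :=
        mul_le_mul_of_nonneg_left (hμ f' g' hf' hg' hfb' hgb') hK'
    _ = K' * K * ((∫ w, f' (w 0) ∂μ) ^ a * (∫ w, g' (w 1) ∂μ) ^ b) := (mul_assoc ..).symm

lemma LipschitzTwoFunctionBound.convPow {μ : Measure (EuclideanSpace ℝ (Fin 2))}
    [IsProbabilityMeasure μ] (hm : 0 ≤ m) (ha : 0 ≤ a) (hb : 0 ≤ b) (hK : 0 ≤ K)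
    (h : LipschitzTwoFunctionBound a b m M L K μ) (n : ℕ) :
    LipschitzTwoFunctionBound a b m M L (K ^ n) (convPow μ n) := by
  induction n with
  | zero => exact fun f g _ _ _ _ => by simp [GaussianChaos.convPow]
  | succ n ih =>
    rw [pow_succ']
    exact ih.conv hm ha hb hK h

lemma exists_eq_mul_one_add_mul_sign (hm : 0 < m) (hf : LipschitzWith L f) (hfm : ∀ x, m ≤ f x)
    {σ : ℝ} (hσ : 0 ≤ σ) : ∃ α : ℝ, |α| ≤ L / m * σ ∧
      ∀ ε : ℝ, |ε| = 1 → f (σ * ε) = (f σ + f (-σ)) / 2 * (1 + α * ε) := by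
  have hmean : m ≤ (f σ + f (-σ)) / 2 := by linarith [hfm σ, hfm (-σ)]
  have hmean0 : 0 < (f σ + f (-σ)) / 2 := hm.trans_le hmean
  have hdiff : |(f σ - f (-σ)) / 2| ≤ L * σ := by
    have h := hf.dist_le_mul σ (-σ)
    rw [Real.dist_eq, Real.dist_eq, sub_neg_eq_add, abs_of_nonneg (add_nonneg hσ hσ)] at h
    rw [abs_div, abs_two]
    linarith
  refine ⟨(f σ - f (-σ)) / 2 / ((f σ + f (-σ)) / 2), ?_, fun ε hε => ?_⟩
  · rw [abs_div, abs_of_pos hmean0, div_mul_eq_mul_div]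
    exact div_le_div₀ (by positivity) hdiff hm hmean
  · rw [mul_add, mul_one, ← mul_assoc, mul_div_cancel₀ _ hmean0.ne']
    rcases eq_or_eq_neg_of_abs_eq hε with rfl | rfl
    · rw [mul_one]
      ring
    · rw [mul_neg_one]
      ring

lemma exists_lipschitzTwoFunctionBound_signPair {ρ : ℝ} (ha : 0 < a) (ha1 : a < 1) (hb : 0 < b)
    (hb1 : b < 1) (hρ1 : |ρ| ≤ 1) (hρ : a * b * ρ ^ 2 ≤ (1 - a) * (1 - b)) (hm : 0 < m) (M : ℝ)
    (L : NNReal) : ∃ C : ℝ, 0 ≤ C ∧ ∀ᶠ σ : ℝ in 𝓝[>] 0,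
      LipschitzTwoFunctionBound a b m M L (1 + C * σ ^ 3) (signPair ρ σ) := by
  obtain ⟨C, hC0, hC⟩ := exists_signMean_rpow_le ha ha1 hb hb1 hρ1 hρ
  have hκ : 0 < (L + 1) / m := by positivity
  have hscale : Tendsto (fun σ : ℝ => (L + 1) / m * σ) (𝓝[>] 0) (𝓝[>] 0) :=
    tendsto_nhdsWithin_iff.2 ⟨((continuous_const_mul _).tendsto' 0 0 (mul_zero _)).mono_left
      nhdsWithin_le_nhds, eventually_mem_nhdsWithin.mono fun σ hσ => mul_pos hκ hσ⟩
  refine ⟨C * ((L + 1) / m) ^ 3, by positivity, ?_⟩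
  filter_upwards [hscale.eventually hC, self_mem_nhdsWithin] with σ hσC (hσ : 0 < σ)
  intro f g hf hg hfb hgb
  obtain ⟨α, hα, hfα⟩ := exists_eq_mul_one_add_mul_sign hm hf (fun x => (hfb x).1) hσ.le
  obtain ⟨β, hβ, hgβ⟩ := exists_eq_mul_one_add_mul_sign hm hg (fun x => (hgb x).1) hσ.le
  set u := (f σ + f (-σ)) / 2
  set v := (g σ + g (-σ)) / 2
  have hu : 0 < u := half_pos (add_pos (hm.trans_le (hfb σ).1) (hm.trans_le (hfb (-σ)).1))
  have hv : 0 < v := half_pos (add_pos (hm.trans_le (hgb σ).1) (hm.trans_le (hgb (-σ)).1))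
  have hα0 (ε : ℝ) (hε : |ε| = 1) : 0 ≤ 1 + α * ε :=
    nonneg_of_mul_nonneg_right (hm.le.trans ((hfb (σ * ε)).1.trans_eq (hfα ε hε))) hu
  have hβ0 (δ : ℝ) (hδ : |δ| = 1) : 0 ≤ 1 + β * δ :=
    nonneg_of_mul_nonneg_right (hm.le.trans ((hgb (σ * δ)).1.trans_eq (hgβ δ hδ))) hv
  have hsmall : L / m * σ ≤ (L + 1) / m * σ := by
    gcongr
    exact le_add_of_nonneg_right zero_le_one
  rw [integral_signPair_coord hρ1, integral_signPair_coord hρ1, integral_signPair hρ1]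
  calc signMean ρ (fun ε δ => f (σ * ε) ^ a * g (σ * δ) ^ b)
      ≤ signMean ρ (fun ε δ => (u ^ a * v ^ b) * ((1 + α * ε) ^ a * (1 + β * δ) ^ b)) := by
        refine signMean_mono hρ1 fun ε δ hε hδ => le_of_eq ?_
        rw [hfα ε hε, hgβ δ hδ, Real.mul_rpow hu.le (hα0 ε hε), Real.mul_rpow hv.le (hβ0 δ hδ)]
        ring
    _ = (u ^ a * v ^ b) * signMean ρ (fun ε δ => (1 + α * ε) ^ a * (1 + β * δ) ^ b) := by
        simp only [signMean, smul_eq_mul]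
        ring
    _ ≤ (u ^ a * v ^ b) * (1 + C * ((L + 1) / m * σ) ^ 3) := by
        gcongr
        exact hσC α β (hα.trans hsmall) (hβ.trans hsmall)
    _ = (1 + C * ((L + 1) / m) ^ 3 * σ ^ 3) * (u ^ a * v ^ b) := by ring

end Convolution

section CentralLimit

variable {a b ρ ρ' m M : ℝ} {L : NNReal}

/-- The law of `(x, ρ x + ρ' y)` for independent standard Gaussians `x` and `y`. -/
noncomputable def gaussianPair (ρ ρ' : ℝ) : Measure (EuclideanSpace ℝ (Fin 2)) :=
  ((gaussianReal 0 1).prod (gaussianReal 0 1)).map fun z => !₂[z.1, ρ * z.1 + ρ' * z.2]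

instance : IsProbabilityMeasure (gaussianPair ρ ρ') :=
  Measure.isProbabilityMeasure_map (by fun_prop)

lemma charFun_gaussianPair (h : ρ ^ 2 + ρ' ^ 2 = 1) (t : EuclideanSpace ℝ (Fin 2)) :
    charFun (gaussianPair ρ ρ') t =
      (Real.exp (-(t 0 ^ 2 + 2 * ρ * (t 0 * t 1) + t 1 ^ 2) / 2) : ℝ) := by
  have hexp (x y : ℝ) : Complex.exp ((inner ℝ !₂[x, ρ * x + ρ' * y] t : ℝ) * Complex.I) =
      Complex.exp ((t 0 + ρ * t 1 : ℝ) * x * Complex.I) *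
        Complex.exp ((ρ' * t 1 : ℝ) * y * Complex.I) := by
    rw [← Complex.exp_add]
    congr 1
    simp [PiLp.inner_apply, Fin.sum_univ_two]
    ring
  rw [charFun_apply, gaussianPair, integral_map (by fun_prop) (by fun_prop)]
  simp only [hexp]
  rw [integral_prod_mul (fun x : ℝ => Complex.exp ((t 0 + ρ * t 1 : ℝ) * x * Complex.I))
    (fun y : ℝ => Complex.exp ((ρ' * t 1 : ℝ) * y * Complex.I)), ← charFun_apply_real,
    ← charFun_apply_real, charFun_gaussianReal, charFun_gaussianReal, ← Complex.exp_add]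
  rw [Complex.ofReal_exp]
  congr 1
  have h' : (ρ : ℂ) ^ 2 + (ρ' : ℂ) ^ 2 = 1 := by exact_mod_cast h
  push_cast
  linear_combination (-(t 1 : ℂ) ^ 2 / 2) * h'

lemma charFun_signPair (hρ : |ρ| ≤ 1) (σ : ℝ) (t : EuclideanSpace ℝ (Fin 2)) :
    charFun (signPair ρ σ) t = ((1 + ρ) / 2 * Real.cos (σ * (t 0 + t 1)) +
      (1 - ρ) / 2 * Real.cos (σ * (t 0 - t 1)) : ℝ) := by
  rw [charFun_apply, integral_signPair hρ]
  simp [signMean, PiLp.inner_apply, Fin.sum_univ_two, Complex.cos]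
  ring_nf

lemma tendsto_inv_sqrt_atTop : Tendsto (fun n : ℕ => (√n)⁻¹) atTop (𝓝[>] 0) :=
  tendsto_inv_atTop_nhdsGT_zero.comp <|
    Real.tendsto_sqrt_atTop.comp tendsto_natCast_atTop_atTop

lemma tendsto_mul_cos_inv_sqrt_sub_one (x : ℝ) :
    Tendsto (fun n : ℕ => n * (Real.cos ((√n)⁻¹ * x) - 1)) atTop (𝓝 (-x ^ 2 / 2)) := by
  have hzero : Tendsto (fun n : ℕ => (√n)⁻¹ * x / 2) atTop (𝓝 0) := by
    simpa using ((tendsto_inv_sqrt_atTop.mono_right nhdsWithin_le_nhds).mul_const x).div_const 2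
  have hsinc := ((Real.continuous_sinc.tendsto 0).comp hzero).pow 2 |>.const_mul (-x ^ 2 / 2)
  rw [Real.sinc_zero, one_pow, mul_one] at hsinc
  refine hsinc.congr' ?_
  filter_upwards [eventually_gt_atTop 0] with n hn
  have hn2 : (n : ℝ) * (√n)⁻¹ ^ 2 = 1 := by
    rw [inv_pow, Real.sq_sqrt n.cast_nonneg, mul_inv_cancel₀ (Nat.cast_ne_zero.2 hn.ne')]
  have hcos (y : ℝ) : Real.cos y - 1 = -2 * Real.sin (y / 2) ^ 2 := by
    rw [Real.sin_sq_eq_half_sub, mul_div_cancel₀ y two_ne_zero]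
    ring
  have hsin (y : ℝ) : Real.sin y = y * Real.sinc y := by
    rcases eq_or_ne y 0 with rfl | hy
    · simp
    · rw [Real.sinc_of_ne_zero hy, mul_div_cancel₀ _ hy]
  rw [hcos, hsin, Function.comp_apply]
  linear_combination (x ^ 2 / 2 * Real.sinc ((√n)⁻¹ * x / 2) ^ 2) * hn2

lemma tendsto_charFun_signPair_pow (hρ : |ρ| ≤ 1) (t : EuclideanSpace ℝ (Fin 2)) :
    Tendsto (fun n : ℕ => charFun (signPair ρ (√n)⁻¹) t ^ n) atTop
      (𝓝 (Real.exp (-(t 0 ^ 2 + 2 * ρ * (t 0 * t 1) + t 1 ^ 2) / 2) : ℝ)) := by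
  have h := Real.tendsto_one_add_pow_exp_of_tendsto <| show Tendsto
    (fun n : ℕ => n * ((1 + ρ) / 2 * (Real.cos ((√n)⁻¹ * (t 0 + t 1)) - 1) +
      (1 - ρ) / 2 * (Real.cos ((√n)⁻¹ * (t 0 - t 1)) - 1))) atTop
      (𝓝 (-(t 0 ^ 2 + 2 * ρ * (t 0 * t 1) + t 1 ^ 2) / 2)) by
    convert ((tendsto_mul_cos_inv_sqrt_sub_one (t 0 + t 1)).const_mul ((1 + ρ) / 2)).add
      ((tendsto_mul_cos_inv_sqrt_sub_one (t 0 - t 1)).const_mul ((1 - ρ) / 2)) using 2 <;> ring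
  refine (Complex.continuous_ofReal.tendsto _ |>.comp h).congr fun n => ?_
  rw [charFun_signPair hρ, Function.comp_apply, ← Complex.ofReal_pow]
  congr 2
  ring

lemma tendsto_integral_convPow_signPair (h : ρ ^ 2 + ρ' ^ 2 = 1)
    {φ : EuclideanSpace ℝ (Fin 2) → ℝ} (hφ : Continuous φ) {B : ℝ} (hB : ∀ w, ‖φ w‖ ≤ B) :
    Tendsto (fun n : ℕ => ∫ w, φ w ∂convPow (signPair ρ (√n)⁻¹) n) atTop
      (𝓝 (∫ w, φ w ∂gaussianPair ρ ρ')) := by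
  have hρ : |ρ| ≤ 1 := abs_le_one_iff_mul_self_le_one.2 (by nlinarith [sq_nonneg ρ'])
  have := isProbabilityMeasure_signPair hρ
  let μ (n : ℕ) : ProbabilityMeasure (EuclideanSpace ℝ (Fin 2)) :=
    ⟨convPow (signPair ρ (√n)⁻¹) n, inferInstance⟩
  have hμ : Tendsto μ atTop (𝓝 ⟨gaussianPair ρ ρ', inferInstance⟩) := by
    refine ProbabilityMeasure.tendsto_iff_tendsto_charFun.2 fun t => ?_
    simpa only [μ, ProbabilityMeasure.coe_mk, charFun_convPow, charFun_gaussianPair h] using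
      tendsto_charFun_signPair_pow hρ t
  exact ProbabilityMeasure.tendsto_iff_forall_integral_tendsto.1 hμ
    (.ofNormedAddCommGroup φ hφ B hB)

lemma tendsto_one_add_mul_inv_sqrt_cube_pow (C : ℝ) :
    Tendsto (fun n : ℕ => (1 + C * (√n)⁻¹ ^ 3) ^ n) atTop (𝓝 1) := by
  nth_rewrite 2 [← Real.exp_zero]
  refine Real.tendsto_one_add_pow_exp_of_tendsto ?_
  have h := (tendsto_inv_sqrt_atTop.mono_right nhdsWithin_le_nhds).const_mul C
  rw [mul_zero] at h
  refine h.congr' ?_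
  filter_upwards [eventually_gt_atTop 0] with n hn
  have hn2 : (n : ℝ) * (√n)⁻¹ ^ 2 = 1 := by
    rw [inv_pow, Real.sq_sqrt n.cast_nonneg, mul_inv_cancel₀ (Nat.cast_ne_zero.2 hn.ne')]
  linear_combination (-C * (√n)⁻¹) * hn2

theorem lipschitzTwoFunctionBound_gaussianPair (ha : 0 < a) (ha1 : a < 1) (hb : 0 < b)
    (hb1 : b < 1) (h : ρ ^ 2 + ρ' ^ 2 = 1) (hρ : a * b * ρ ^ 2 ≤ (1 - a) * (1 - b)) (hm : 0 < m) :
    LipschitzTwoFunctionBound a b m M L 1 (gaussianPair ρ ρ') := by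
  have hρ1 : |ρ| ≤ 1 := abs_le_one_iff_mul_self_le_one.2 (by nlinarith [sq_nonneg ρ'])
  have := isProbabilityMeasure_signPair hρ1
  intro f g hf hg hfb hgb
  obtain ⟨C, hC0, hC⟩ := exists_lipschitzTwoFunctionBound_signPair ha ha1 hb hb1 hρ1 hρ hm M L
  have hprod := tendsto_integral_convPow_signPair h (φ := fun w => f (w 0) ^ a * g (w 1) ^ b)
    (((hf.continuous.comp (by fun_prop)).rpow_const fun _ => .inr ha.le).mul
      ((hg.continuous.comp (by fun_prop)).rpow_const fun _ => .inr hb.le))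
    fun w => norm_rpow_mul_rpow_le hm.le ha.le hb.le (hfb _) (hgb _)
  have hmean (i : Fin 2) {f : ℝ → ℝ} (hf : LipschitzWith L f) (hfb : ∀ x, f x ∈ Set.Icc m M) :=
    tendsto_integral_convPow_signPair h (φ := fun w => f (w i))
      (hf.continuous.comp (by fun_prop)) (B := M)
      fun w => by
        rw [Real.norm_of_nonneg (hm.le.trans (hfb _).1)]
        exact (hfb _).2
  refine le_of_tendsto_of_tendsto hprod ((tendsto_one_add_mul_inv_sqrt_cube_pow C).mul
    (((hmean 0 hf hfb).rpow_const (.inr ha.le)).mul ((hmean 1 hg hgb).rpow_const (.inr hb.le)))) ?_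
  filter_upwards [tendsto_inv_sqrt_atTop.eventually hC] with n hn
  exact hn.convPow hm.le ha.le hb.le (by positivity) n f g hf hg hfb hgb

end CentralLimit

section HypercontractivePair

variable {Ω Ω' α α' β β' : Type*} [MeasurableSpace Ω] [MeasurableSpace Ω'] [MeasurableSpace α]
  [MeasurableSpace α'] [MeasurableSpace β] [MeasurableSpace β'] {P : Measure Ω} {P' : Measure Ω'}
  {X : Ω → α} {X' : Ω' → α'} {Y : Ω → β} {Y' : Ω' → β'} {a b : ℝ}

lemma lintegral_le_of_tendsto_ae {f : ℕ → Ω → ℝ≥0∞} {g : Ω → ℝ≥0∞} {u : ℕ → ℝ≥0∞} {c : ℝ≥0∞}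
    (hf : ∀ k, AEMeasurable (f k) P) (hfg : ∀ᵐ ω ∂P, Tendsto (fun k => f k ω) atTop (𝓝 (g ω)))
    (hfu : ∀ k, ∫⁻ ω, f k ω ∂P ≤ u k) (hu : Tendsto u atTop (𝓝 c)) : ∫⁻ ω, g ω ∂P ≤ c :=
  calc ∫⁻ ω, g ω ∂P = ∫⁻ ω, liminf (fun k => f k ω) atTop ∂P :=
        lintegral_congr_ae (hfg.mono fun _ hω => hω.liminf_eq.symm)
    _ ≤ liminf (fun k => ∫⁻ ω, f k ω ∂P) atTop := lintegral_liminf_le' hf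
    _ ≤ liminf u atTop := liminf_le_liminf (Eventually.of_forall hfu)
    _ = c := hu.liminf_eq

lemma tendsto_min_natCast (x : ℝ≥0∞) : Tendsto (fun k : ℕ => min x k) atTop (𝓝 x) := by
  simpa using tendsto_const_nhds.min ENNReal.tendsto_nat_nhds_top

lemma tendsto_min_rpow_mul_min_rpow (ha : 0 < a) (hb : 0 < b) (x y : ℝ≥0∞) :
    Tendsto (fun k : ℕ => min x k ^ a * min y k ^ b) atTop (𝓝 (x ^ a * y ^ b)) := by
  rcases eq_or_ne x 0 with rfl | hx
  · simp [ha]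
  rcases eq_or_ne y 0 with rfl | hy
  · simp [hb]
  refine ENNReal.Tendsto.mul ((tendsto_min_natCast x).ennrpow_const a) (.inl ?_)
    ((tendsto_min_natCast y).ennrpow_const b) (.inl ?_)
  · simp [ENNReal.rpow_eq_zero_iff, hx, ha.not_gt]
  · simp [ENNReal.rpow_eq_zero_iff, hy, hb.not_gt]

/-- The two-function form of hypercontractivity for a pair of random elements `X` and `Y`. With
`a = 1 - 1 / r` and `b = 1 / p`, duality makes it say that conditional expectation given `X` is a
contraction from the `L^p` space of `Y` to `L^r`. -/
def HypercontractivePair (a b : ℝ) (P : Measure Ω) (X : Ω → α) (Y : Ω → β) : Prop :=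
  ∀ (F : α → ℝ≥0∞) (G : β → ℝ≥0∞), Measurable F → Measurable G →
    ∫⁻ ω, F (X ω) ^ a * G (Y ω) ^ b ∂P ≤ (∫⁻ ω, F (X ω) ∂P) ^ a * (∫⁻ ω, G (Y ω) ∂P) ^ b

lemma measurable_rpow_mul_rpow {F : α → ℝ≥0∞} {G : β → ℝ≥0∞} (hX : Measurable X)
    (hY : Measurable Y) (hF : Measurable F) (hG : Measurable G) (a b : ℝ) :
    Measurable fun ω => F (X ω) ^ a * G (Y ω) ^ b :=
  ((hF.comp hX).pow_const a).mul ((hG.comp hY).pow_const b)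

lemma hypercontractivePair_of_forall_bounded (hX : Measurable X) (hY : Measurable Y)
    (ha : 0 < a) (hb : 0 < b)
    (h : ∀ (k : ℕ) (F : α → ℝ≥0∞) (G : β → ℝ≥0∞), Measurable F → Measurable G →
      (∀ x, F x ≤ k) → (∀ y, G y ≤ k) →
      ∫⁻ ω, F (X ω) ^ a * G (Y ω) ^ b ∂P ≤ (∫⁻ ω, F (X ω) ∂P) ^ a * (∫⁻ ω, G (Y ω) ∂P) ^ b) :
    HypercontractivePair a b P X Y := by
  intro F G hF hG
  have hminF (k : ℕ) : Measurable fun x => min (F x) k := hF.min measurable_const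
  have hminG (k : ℕ) : Measurable fun y => min (G y) k := hG.min measurable_const
  refine lintegral_le_of_tendsto_ae
    (fun k => (measurable_rpow_mul_rpow hX hY (hminF k) (hminG k) a b).aemeasurable)
    (ae_of_all _ fun ω => tendsto_min_rpow_mul_min_rpow ha hb (F (X ω)) (G (Y ω)))
    (fun k => (h k _ _ (hminF k) (hminG k) (fun _ => min_le_right _ _)
      fun _ => min_le_right _ _).trans ?_) tendsto_const_nhds
  gcongr <;> exact min_le_left _ _

lemma HypercontractivePair.comp {φ : α → α'} {ψ : β → β'} (h : HypercontractivePair a b P X Y)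
    (hφ : Measurable φ) (hψ : Measurable ψ) :
    HypercontractivePair a b P (φ ∘ X) (ψ ∘ Y) :=
  fun F G hF hG => h (F ∘ φ) (G ∘ ψ) (hF.comp hφ) (hG.comp hψ)

lemma hypercontractivePair_comp_iff {T : Ω' → Ω} (hT : MeasurePreserving T P' P)
    (hX : Measurable X) (hY : Measurable Y) :
    HypercontractivePair a b P' (X ∘ T) (Y ∘ T) ↔ HypercontractivePair a b P X Y := by
  refine forall₄_congr fun F G hF hG => ?_
  rw [← hT.lintegral_comp (measurable_rpow_mul_rpow hX hY hF hG a b),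
    ← hT.lintegral_comp (f := fun ω => F (X ω)) (hF.comp hX),
    ← hT.lintegral_comp (f := fun ω => G (Y ω)) (hG.comp hY)]
  rfl

lemma HypercontractivePair.prodMap [SFinite P'] (h : HypercontractivePair a b P X Y)
    (h' : HypercontractivePair a b P' X' Y') (hX : Measurable X) (hX' : Measurable X')
    (hY : Measurable Y) (hY' : Measurable Y') :
    HypercontractivePair a b (P.prod P') (Prod.map X X') (Prod.map Y Y') := by
  intro F G hF hG
  have hFX : Measurable fun z => F (Prod.map X X' z) := hF.comp (hX.prodMap hX')
  have hGY : Measurable fun z => G (Prod.map Y Y' z) := hG.comp (hY.prodMap hY')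
  have hFX' : Measurable fun x => ∫⁻ ω', F (x, X' ω') ∂P' :=
    (hF.comp (measurable_id.prodMap hX')).lintegral_prod_right'
  have hGY' : Measurable fun y => ∫⁻ ω', G (y, Y' ω') ∂P' :=
    (hG.comp (measurable_id.prodMap hY')).lintegral_prod_right'
  rw [lintegral_prod _ (measurable_rpow_mul_rpow (hX.prodMap hX') (hY.prodMap hY') hF hG a
    b).aemeasurable,
    lintegral_prod _ hFX.aemeasurable, lintegral_prod _ hGY.aemeasurable]
  exact (lintegral_mono fun ω => h' _ _ (hF.comp measurable_prodMk_left)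
    (hG.comp measurable_prodMk_left)).trans (h _ _ hFX' hGY')

lemma HypercontractivePair.pi [SigmaFinite P] (h : HypercontractivePair a b P X Y)
    (hX : Measurable X) (hY : Measurable Y) (n : ℕ) :
    HypercontractivePair a b (Measure.pi fun _ : Fin n => P) (fun ω i => X (ω i))
      fun ω i => Y (ω i) := by
  induction n with
  | zero =>
    intro F G _ _
    simp only [lintegral_unique, Measure.pi_empty_univ, mul_one, le_refl]
  | succ n ih =>
    have hT := measurePreserving_piFinSuccAbove (fun _ : Fin (n + 1) => P) 0
    have hX' : Measurable fun (ω : Fin n → Ω) i => X (ω i) := by fun_prop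
    have hY' : Measurable fun (ω : Fin n → Ω) i => Y (ω i) := by fun_prop
    have hprod := (hypercontractivePair_comp_iff hT (hX.prodMap hX')
      (hY.prodMap hY')).2 (h.prodMap ih hX hX' hY hY')
    convert hprod.comp (MeasurableEquiv.piFinSuccAbove (fun _ => α) 0).symm.measurable
      (MeasurableEquiv.piFinSuccAbove (fun _ => β) 0).symm.measurable using 1
    · exact funext fun ω => (MeasurableEquiv.symm_apply_eq _).2 rfl |>.symm
    · exact funext fun ω => (MeasurableEquiv.symm_apply_eq _).2 rfl |>.symm

lemma le_rpow_of_le_rpow_mul {r : ℝ} (hr : 0 < r) {A B : ℝ≥0∞} (hA : A ≠ ∞)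
    (h : A ≤ A ^ (1 - 1 / r) * B) : A ≤ B ^ r := by
  rcases eq_or_ne A 0 with rfl | hA0
  · exact zero_le
  have hroot : A ^ (1 / r) ≤ B := by
    rw [← ENNReal.mul_le_mul_iff_right (a := A ^ (1 - 1 / r))
      (by simp [ENNReal.rpow_eq_zero_iff, hA0, hA]) (ENNReal.rpow_ne_top_of_ne_zero hA0 hA),
      ← ENNReal.rpow_add _ _ hA0 hA, sub_add_cancel, ENNReal.rpow_one]
    exact h
  rwa [one_div, ENNReal.rpow_inv_le_iff hr] at hroot

lemma rpow_le_rpow_sub_one_mul {r : ℝ} (hr : 1 ≤ r) {x y : ℝ≥0∞} (h : x ≤ y) :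
    x ^ r ≤ x ^ (r - 1) * y :=
  calc x ^ r = x ^ (r - 1) * x ^ (1 : ℝ) := by
        rw [← ENNReal.rpow_add_of_nonneg _ _ (sub_nonneg.2 hr) zero_le_one, sub_add_cancel]
    _ = x ^ (r - 1) * x := by rw [ENNReal.rpow_one]
    _ ≤ x ^ (r - 1) * y := mul_le_mul_right h _

variable {μ : Measure α} {ν : Measure β} [IsFiniteMeasure μ] [IsProbabilityMeasure ν] {γ : Type*}
  [MeasurableSpace γ] {Z : α × β → γ} {p r : ℝ} {M : γ → ℝ≥0∞}

lemma HypercontractivePair.lintegral_min_rpow_le (hp : 1 < p) (hr : 1 < r)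
    (h : HypercontractivePair (1 - 1 / r) (1 / p) (μ.prod ν) Prod.fst Z) (hZ : Measurable Z)
    (hM : Measurable M) (k : ℕ) :
    ∫⁻ w, min (∫⁻ z, M (Z (w, z)) ∂ν) k ^ r ∂μ ≤
      ((∫⁻ y, M (Z y) ^ p ∂μ.prod ν) ^ (1 / p)) ^ r := by
  set T : α → ℝ≥0∞ := fun w => min (∫⁻ z, M (Z (w, z)) ∂ν) k
  have hr0 : 0 < r := zero_lt_one.trans hr
  have hT : Measurable fun w => T w ^ r :=
    ((hM.comp hZ).lintegral_prod_right'.min measurable_const).pow_const r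
  have hfin : ∫⁻ w, T w ^ r ∂μ ≠ ∞ := by
    refine (IsFiniteMeasure.lintegral_lt_top_of_bounded_to_ennreal μ
      ⟨(k : NNReal) ^ r, fun w => ?_⟩).ne
    rw [ENNReal.coe_rpow_of_nonneg _ hr0.le]
    exact ENNReal.rpow_le_rpow (min_le_right _ _) hr0.le
  refine le_rpow_of_le_rpow_mul hr0 hfin ?_
  calc ∫⁻ w, T w ^ r ∂μ
      ≤ ∫⁻ w, ∫⁻ z, (T w ^ r) ^ (1 - 1 / r) * (M (Z (w, z)) ^ p) ^ (1 / p) ∂ν ∂μ := by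
        refine lintegral_mono fun w => ?_
        have hp0 : p * (1 / p) = 1 := mul_one_div_cancel (zero_lt_one.trans hp).ne'
        have hr1 : r * (1 - 1 / r) = r - 1 := by rw [mul_sub, mul_one_div_cancel hr0.ne', mul_one]
        simp only [← ENNReal.rpow_mul, hp0, hr1, ENNReal.rpow_one]
        exact (rpow_le_rpow_sub_one_mul hr.le (min_le_left _ _)).trans_eq (lintegral_const_mul _
          (hM.comp (hZ.comp measurable_prodMk_left))).symm
    _ = ∫⁻ y, (T y.1 ^ r) ^ (1 - 1 / r) * (M (Z y) ^ p) ^ (1 / p) ∂μ.prod ν :=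
        (lintegral_prod _ (measurable_rpow_mul_rpow measurable_fst hZ hT (hM.pow_const p) _
          _).aemeasurable).symm
    _ ≤ (∫⁻ y, T y.1 ^ r ∂μ.prod ν) ^ (1 - 1 / r) *
          (∫⁻ y, M (Z y) ^ p ∂μ.prod ν) ^ (1 / p) :=
        h (fun w => T w ^ r) (fun y => M y ^ p) hT (hM.pow_const p)
    _ = (∫⁻ w, T w ^ r ∂μ) ^ (1 - 1 / r) * (∫⁻ y, M (Z y) ^ p ∂μ.prod ν) ^ (1 / p) := by
        rw [measurePreserving_fst.lintegral_comp hT]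

theorem HypercontractivePair.rpow_lintegral_le (hp : 1 < p) (hr : 1 < r)
    (h : HypercontractivePair (1 - 1 / r) (1 / p) (μ.prod ν) Prod.fst Z) (hZ : Measurable Z)
    (hM : Measurable M) :
    (∫⁻ w, (∫⁻ z, M (Z (w, z)) ∂ν) ^ r ∂μ) ^ (1 / r) ≤
      (∫⁻ y, M (Z y) ^ p ∂μ.prod ν) ^ (1 / p) := by
  have hS : Measurable fun w => ∫⁻ z, M (Z (w, z)) ∂ν := (hM.comp hZ).lintegral_prod_right'
  rw [one_div r, ENNReal.rpow_inv_le_iff (zero_lt_one.trans hr)]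
  exact lintegral_le_of_tendsto_ae
    (fun k => ((hS.min measurable_const).pow_const r).aemeasurable)
    (ae_of_all _ fun w => (tendsto_min_natCast _).ennrpow_const r)
    (h.lintegral_min_rpow_le hp hr hZ hM) tendsto_const_nhds

end HypercontractivePair

section GaussianHypercontractivity

variable {a b ρ ρ' : ℝ}

/-- Lipschitz functions with values in a compact subset of `(0, ∞)`: the class of test functions
that is stable under averaging over translations and dense in the nonnegative part of `L¹`. -/
def IsPosLipschitz (f : ℝ → ℝ) : Prop :=
  ∃ m > 0, ∃ (M : ℝ) (L : NNReal), LipschitzWith L f ∧ ∀ x, f x ∈ Set.Icc m M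

lemma IsPosLipschitz.continuous {f : ℝ → ℝ} (hf : IsPosLipschitz f) : Continuous f := by
  obtain ⟨_, _, _, _, hf, _⟩ := hf
  exact hf.continuous

lemma IsPosLipschitz.nonneg {f : ℝ → ℝ} (hf : IsPosLipschitz f) (x : ℝ) : 0 ≤ f x := by
  obtain ⟨m, hm, _, _, _, h⟩ := hf
  exact hm.le.trans (h x).1

lemma IsPosLipschitz.integrable {f : ℝ → ℝ} (hf : IsPosLipschitz f) (μ : Measure ℝ)
    [IsFiniteMeasure μ] : Integrable f μ := by
  obtain ⟨m, _, M, _, hf, h⟩ := hf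
  exact .of_mem_Icc m M hf.continuous.aemeasurable (ae_of_all _ h)

lemma IsPosLipschitz.exists_common_bounds {f g : ℝ → ℝ} (hf : IsPosLipschitz f)
    (hg : IsPosLipschitz g) : ∃ m > 0, ∃ (M : ℝ) (L : NNReal), LipschitzWith L f ∧
      LipschitzWith L g ∧ (∀ x, f x ∈ Set.Icc m M) ∧ ∀ x, g x ∈ Set.Icc m M := by
  obtain ⟨m, hm, M, L, hf, hfb⟩ := hf
  obtain ⟨m', hm', M', L', hg, hgb⟩ := hg
  exact ⟨min m m', lt_min hm hm', max M M', max L L', hf.weaken (le_max_left _ _),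
    hg.weaken (le_max_right _ _),
    fun x => Set.Icc_subset_Icc (min_le_left _ _) (le_max_left _ _) (hfb x),
    fun x => Set.Icc_subset_Icc (min_le_right _ _) (le_max_right _ _) (hgb x)⟩

lemma exists_isPosLipschitz_eLpNorm_sub_le {μ : Measure ℝ} [IsProbabilityMeasure μ]
    {φ : ℝ → ℝ} (hφ : Integrable φ μ) (hφ0 : ∀ x, 0 ≤ φ x) {ε : ℝ} (hε : 0 < ε) :
    ∃ f : ℝ → ℝ, IsPosLipschitz f ∧ eLpNorm (f - φ) 1 μ ≤ ENNReal.ofReal ε := by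
  have hδ : 0 < ε / 2 := half_pos hε
  obtain ⟨g, hg, hgs, hgφ⟩ := (memLp_one_iff_integrable.2 hφ).exist_eLpNorm_sub_le
    ENNReal.one_ne_top le_rfl hδ
  obtain ⟨L, hL⟩ := hgs.lipschitzWith_of_hasCompactSupport hg (by simp)
  obtain ⟨C, hC⟩ := hg.exists_bound_of_continuous hgs.continuous
  refine ⟨fun x => |g x| + ε / 2, ⟨ε / 2, hδ, C + ε / 2, L, ?_, fun x => ⟨?_, ?_⟩⟩, ?_⟩
  · refine .of_dist_le_mul fun x y => (le_of_eq_of_le (dist_add_right _ _ _) ?_).trans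
      (hL.dist_le_mul x y)
    exact abs_abs_sub_abs_le _ _
  · exact le_add_of_nonneg_left (abs_nonneg _)
  · exact add_le_add_left (hC x) _
  · calc eLpNorm ((fun x => |g x| + ε / 2) - φ) 1 μ
        ≤ eLpNorm (fun x => ‖(φ - g) x‖ + ε / 2) 1 μ := by
          refine eLpNorm_mono_real fun x => abs_le.2 ⟨?_, ?_⟩ <;>
          simp only [Pi.sub_apply, Real.norm_eq_abs] <;>
          linarith [abs_sub_abs_le_abs_sub (φ x) (g x), abs_sub_abs_le_abs_sub (g x) (φ x),
            abs_sub_comm (φ x) (g x), abs_of_nonneg (hφ0 x)]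
      _ ≤ eLpNorm (fun x => ‖(φ - g) x‖) 1 μ + eLpNorm (fun _ => ε / 2) 1 μ :=
          eLpNorm_add_le (hφ.1.sub hgs.continuous.aestronglyMeasurable).norm
            aestronglyMeasurable_const le_rfl
      _ ≤ ENNReal.ofReal (ε / 2) + ENNReal.ofReal (ε / 2) := by
          rw [eLpNorm_norm, eLpNorm_const _ one_ne_zero (NeZero.ne μ), measure_univ,
            ENNReal.one_rpow, mul_one, Real.enorm_of_nonneg hδ.le]
          exact add_le_add_left hgφ _
      _ = ENNReal.ofReal ε := by rw [← ENNReal.ofReal_add hδ.le hδ.le, add_halves]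

lemma exists_seq_isPosLipschitz_tendsto_ae {μ : Measure ℝ} [IsProbabilityMeasure μ] {F : ℝ → ℝ≥0∞}
    (hF : Measurable F) (hFi : ∫⁻ x, F x ∂μ ≠ ∞) :
    ∃ f : ℕ → ℝ → ℝ, (∀ k, IsPosLipschitz (f k)) ∧
      (∀ᵐ x ∂μ, Tendsto (fun k => ENNReal.ofReal (f k x)) atTop (𝓝 (F x))) ∧
      Tendsto (fun k => ENNReal.ofReal (∫ x, f k x ∂μ)) atTop (𝓝 (∫⁻ x, F x ∂μ)) := by
  have hφ : Integrable (fun x => (F x).toReal) μ := integrable_toReal_of_lintegral_ne_top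
    hF.aemeasurable hFi
  choose f hf hfφ using fun k : ℕ => exists_isPosLipschitz_eLpNorm_sub_le hφ
    (fun _ => ENNReal.toReal_nonneg) (Nat.one_div_pos_of_nat (α := ℝ) (n := k))
  have hL1 : Tendsto (fun k => eLpNorm (f k - fun x => (F x).toReal) 1 μ) atTop (𝓝 0) := by
    refine tendsto_of_tendsto_of_tendsto_of_le_of_le tendsto_const_nhds ?_ (fun _ => zero_le) hfφ
    simpa using ENNReal.tendsto_ofReal (tendsto_one_div_add_atTop_nhds_zero_nat (𝕜 := ℝ))
  have hfi (k : ℕ) : Integrable (f k) μ := (hf k).integrable μ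
  obtain ⟨ns, hns, hae⟩ := (tendstoInMeasure_of_tendsto_eLpNorm one_ne_zero
    (fun k => (hfi k).aestronglyMeasurable) hφ.aestronglyMeasurable hL1).exists_seq_tendsto_ae
  refine ⟨fun k => f (ns k), fun k => hf (ns k), ?_, ?_⟩
  · filter_upwards [hae, ae_lt_top hF hFi] with x hx hxt
    simpa [hxt.ne] using ENNReal.tendsto_ofReal hx
  · have hinteg := (tendsto_integral_of_L1' _ hφ.aestronglyMeasurable (.of_forall hfi)
      hL1).comp hns.tendsto_atTop
    rw [integral_toReal hF.aemeasurable (ae_lt_top hF hFi)] at hinteg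
    simpa [hFi] using ENNReal.tendsto_ofReal hinteg

lemma lintegral_ofReal_rpow_mul_rpow_le {Ω : Type*} [MeasurableSpace Ω] {P : Measure Ω}
    [IsProbabilityMeasure P] {X Y : Ω → ℝ} (hX : Measurable X) (hY : Measurable Y)
    (ha : 0 ≤ a) (hb : 0 ≤ b) {f g : ℝ → ℝ} (hf : IsPosLipschitz f) (hg : IsPosLipschitz g)
    (h : ∫ ω, f (X ω) ^ a * g (Y ω) ^ b ∂P ≤ (∫ ω, f (X ω) ∂P) ^ a * (∫ ω, g (Y ω) ∂P) ^ b) :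
    ∫⁻ ω, ENNReal.ofReal (f (X ω)) ^ a * ENNReal.ofReal (g (Y ω)) ^ b ∂P ≤
      ENNReal.ofReal (∫ ω, f (X ω) ∂P) ^ a * ENNReal.ofReal (∫ ω, g (Y ω) ∂P) ^ b := by
  have hfi : 0 ≤ ∫ ω, f (X ω) ∂P := integral_nonneg fun _ => hf.nonneg _
  have hgi : 0 ≤ ∫ ω, g (Y ω) ∂P := integral_nonneg fun _ => hg.nonneg _
  obtain ⟨m, hm, M, _, hfL, hgL, hfb, hgb⟩ := hf.exists_common_bounds hg
  have hfg : Integrable (fun ω => f (X ω) ^ a * g (Y ω) ^ b) P :=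
    integrable_rpow_mul_rpow hX hY hm.le ha hb hfL.continuous hgL.continuous hfb hgb
  have hfg0 (ω : Ω) : 0 ≤ f (X ω) ^ a * g (Y ω) ^ b :=
    mul_nonneg (Real.rpow_nonneg (hf.nonneg _) a) (Real.rpow_nonneg (hg.nonneg _) b)
  simp only [ENNReal.ofReal_rpow_of_nonneg, hf.nonneg, hg.nonneg, hfi, hgi, ha, hb,
    ← ENNReal.ofReal_mul, Real.rpow_nonneg]
  rw [← ofReal_integral_eq_lintegral_ofReal hfg (ae_of_all _ hfg0)]
  exact ENNReal.ofReal_le_ofReal h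

lemma hypercontractivePair_of_forall_isPosLipschitz {Ω : Type*} [MeasurableSpace Ω]
    {P : Measure Ω} [IsProbabilityMeasure P] {X Y : Ω → ℝ} (hX : Measurable X) (hY : Measurable Y)
    (ha : 0 < a) (hb : 0 < b)
    (h : ∀ f g : ℝ → ℝ, IsPosLipschitz f → IsPosLipschitz g →
      ∫ ω, f (X ω) ^ a * g (Y ω) ^ b ∂P ≤ (∫ ω, f (X ω) ∂P) ^ a * (∫ ω, g (Y ω) ∂P) ^ b) :
    HypercontractivePair a b P X Y := by
  refine hypercontractivePair_of_forall_bounded hX hY ha hb fun k F G hF hG hFk hGk => ?_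
  have := Measure.isProbabilityMeasure_map (μ := P) hX.aemeasurable
  have := Measure.isProbabilityMeasure_map (μ := P) hY.aemeasurable
  have hFi : ∫⁻ x, F x ∂(P.map X) ≠ ∞ :=
    ((lintegral_mono hFk).trans_lt (by simp)).ne
  have hGi : ∫⁻ y, G y ∂(P.map Y) ≠ ∞ :=
    ((lintegral_mono hGk).trans_lt (by simp)).ne
  obtain ⟨f, hf, hfF, hfi⟩ := exists_seq_isPosLipschitz_tendsto_ae hF hFi
  obtain ⟨g, hg, hgG, hgi⟩ := exists_seq_isPosLipschitz_tendsto_ae hG hGi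
  rw [lintegral_map hF hX] at hFi hfi
  rw [lintegral_map hG hY] at hGi hgi
  simp only [integral_map hX.aemeasurable (hf _).continuous.aestronglyMeasurable] at hfi
  simp only [integral_map hY.aemeasurable (hg _).continuous.aestronglyMeasurable] at hgi
  refine lintegral_le_of_tendsto_ae (fun n => ?_) ?_
    (fun n => lintegral_ofReal_rpow_mul_rpow_le hX hY ha.le hb.le (hf n) (hg n)
      (h _ _ (hf n) (hg n)))
    (ENNReal.Tendsto.mul (hfi.ennrpow_const a) (.inr (ENNReal.rpow_ne_top_of_nonneg hb.le hGi))
      (hgi.ennrpow_const b) (.inr (ENNReal.rpow_ne_top_of_nonneg ha.le hFi)))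
  · exact (measurable_rpow_mul_rpow hX hY (hf n).continuous.measurable.ennreal_ofReal
      (hg n).continuous.measurable.ennreal_ofReal a b).aemeasurable
  · filter_upwards [ae_of_ae_map hX.aemeasurable hfF, ae_of_ae_map hY.aemeasurable hgG]
      with ω hω hω'
    exact ENNReal.Tendsto.mul (hω.ennrpow_const a)
      (.inr (ENNReal.rpow_ne_top_of_nonneg hb.le
        ((hGk _).trans_lt (ENNReal.natCast_lt_top k)).ne)) (hω'.ennrpow_const b)
      (.inr (ENNReal.rpow_ne_top_of_nonneg ha.le
        ((hFk _).trans_lt (ENNReal.natCast_lt_top k)).ne))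

lemma measurePreserving_rotate (h : ρ ^ 2 + ρ' ^ 2 = 1) (v : NNReal) :
    MeasurePreserving (fun w : ℝ × ℝ => ρ * w.1 + ρ' * w.2)
      ((gaussianReal 0 v).prod (gaussianReal 0 v)) (gaussianReal 0 v) := by
  refine ⟨by fun_prop, ?_⟩
  calc ((gaussianReal 0 v).prod (gaussianReal 0 v)).map (fun w : ℝ × ℝ => ρ * w.1 + ρ' * w.2)
      = ((gaussianReal 0 v).map (ρ * ·)) ∗ ((gaussianReal 0 v).map (ρ' * ·)) := by
        rw [Measure.conv, Measure.map_prod_map _ _ (by fun_prop) (by fun_prop),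
          Measure.map_map (by fun_prop) (by fun_prop)]
        rfl
    _ = gaussianReal 0 v := by
        rw [gaussianReal_map_const_mul, gaussianReal_map_const_mul, gaussianReal_conv_gaussianReal,
          mul_zero, mul_zero, add_zero, ← add_mul]
        congr 1
        ext
        simp [h]

lemma measurePreserving_rotate_pi (h : ρ ^ 2 + ρ' ^ 2 = 1) (v : NNReal) (ι : Type*) [Fintype ι] :
    MeasurePreserving (fun w : (ι → ℝ) × (ι → ℝ) => ρ • w.1 + ρ' • w.2)
      ((Measure.pi fun _ => gaussianReal 0 v).prod (Measure.pi fun _ => gaussianReal 0 v))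
      (Measure.pi fun _ => gaussianReal 0 v) :=
  (measurePreserving_pi _ _ fun _ => measurePreserving_rotate h v).comp
    (measurePreserving_arrowProdEquivProdArrow ℝ ℝ ι (fun _ => gaussianReal 0 v)
      fun _ => gaussianReal 0 v).symm

lemma integral_gaussianPair {F : EuclideanSpace ℝ (Fin 2) → ℝ} (hF : Measurable F) :
    ∫ w, F w ∂gaussianPair ρ ρ' =
      ∫ z, F !₂[z.1, ρ * z.1 + ρ' * z.2] ∂(gaussianReal 0 1).prod (gaussianReal 0 1) :=
  integral_map (by fun_prop) hF.aestronglyMeasurable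

lemma hypercontractivePair_gaussianReal (ha : 0 < a) (ha1 : a < 1) (hb : 0 < b) (hb1 : b < 1)
    (h : ρ ^ 2 + ρ' ^ 2 = 1) (hρ : a * b * ρ ^ 2 ≤ (1 - a) * (1 - b)) :
    HypercontractivePair a b ((gaussianReal 0 1).prod (gaussianReal 0 1)) Prod.fst
      fun z => ρ * z.1 + ρ' * z.2 := by
  refine hypercontractivePair_of_forall_isPosLipschitz measurable_fst (by fun_prop) ha hb
    fun f g hf hg => ?_
  obtain ⟨m, hm, M, L, hfL, hgL, hfb, hgb⟩ := hf.exists_common_bounds hg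
  have key := lipschitzTwoFunctionBound_gaussianPair ha ha1 hb hb1 h hρ hm f g hfL hgL hfb hgb
  have hfm : Measurable fun w : EuclideanSpace ℝ (Fin 2) => f (w 0) :=
    hfL.continuous.measurable.comp (by fun_prop)
  have hgm : Measurable fun w : EuclideanSpace ℝ (Fin 2) => g (w 1) :=
    hgL.continuous.measurable.comp (by fun_prop)
  have hfgm : Measurable fun w : EuclideanSpace ℝ (Fin 2) => f (w 0) ^ a * g (w 1) ^ b :=
    (hfm.pow_const a).mul (hgm.pow_const b)
  rw [integral_gaussianPair hfgm, integral_gaussianPair hfm, integral_gaussianPair hgm,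
    one_mul] at key
  simpa using key

/-- The standard Gaussian measure on `Fin n → ℝ`. -/
noncomputable abbrev stdGaussianPi (n : ℕ) : Measure (Fin n → ℝ) :=
  Measure.pi fun _ => gaussianReal 0 1

lemma hypercontractivePair_stdGaussianPi (ha : 0 < a) (ha1 : a < 1) (hb : 0 < b) (hb1 : b < 1)
    (h : ρ ^ 2 + ρ' ^ 2 = 1) (hρ : a * b * ρ ^ 2 ≤ (1 - a) * (1 - b)) (n : ℕ) :
    HypercontractivePair a b ((stdGaussianPi n).prod (stdGaussianPi n)) Prod.fst
      fun z => ρ • z.1 + ρ' • z.2 :=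
  (hypercontractivePair_comp_iff (measurePreserving_arrowProdEquivProdArrow ℝ ℝ (Fin n)
    (fun _ => gaussianReal 0 1) fun _ => gaussianReal 0 1) measurable_fst (by fun_prop)).1
    ((hypercontractivePair_gaussianReal ha ha1 hb hb1 h hρ).pi measurable_fst (by fun_prop) n)

theorem gaussian_hypercontractivity {p r : ℝ} (hp : 1 < p) (hr : 1 < r)
    (h : ρ ^ 2 + ρ' ^ 2 = 1) (hρ : ρ ^ 2 ≤ (p - 1) / (r - 1)) {n : ℕ}
    {M : (Fin n → ℝ) → ℝ≥0∞} (hM : Measurable M) :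
    (∫⁻ w, (∫⁻ z, M (ρ • w + ρ' • z) ∂stdGaussianPi n) ^ r ∂stdGaussianPi n) ^ (1 / r) ≤
      (∫⁻ x, M x ^ p ∂stdGaussianPi n) ^ (1 / p) := by
  have hp0 : 0 < p := one_pos.trans hp
  have hr0 : 0 < r := one_pos.trans hr
  have hab : (1 - 1 / r) * (1 / p) * ρ ^ 2 ≤ (1 - (1 - 1 / r)) * (1 - 1 / p) := by
    rw [le_div_iff₀ (sub_pos.2 hr)] at hρ
    calc (1 - 1 / r) * (1 / p) * ρ ^ 2 = ρ ^ 2 * (r - 1) / (r * p) := by field_simp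
      _ ≤ (p - 1) / (r * p) := div_le_div_of_nonneg_right hρ (mul_pos hr0 hp0).le
      _ = (1 - (1 - 1 / r)) * (1 - 1 / p) := by field_simp; ring
  have key := (hypercontractivePair_stdGaussianPi (sub_pos.2 ((div_lt_one hr0).2 hr))
    (sub_lt_self _ (one_div_pos.2 hr0)) (one_div_pos.2 hp0) ((div_lt_one hp0).2 hp)
    h hab n).rpow_lintegral_le hp hr (by fun_prop) hM
  rwa [(measurePreserving_rotate_pi h 1 (Fin n)).lintegral_comp (hM.pow_const p)] at key

end GaussianHypercontractivity

section Extrapolation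

variable {d j : ℕ} {ρ : ℝ}

lemma prod_erase_abs_sub (hj : j ≤ d) :
    ∏ i ∈ (Finset.range (d + 1)).erase j, |(j : ℝ) - i| = j.factorial * (d - j).factorial := by
  have hsplit : (Finset.range (d + 1)).erase j =
      Finset.range j ∪ Finset.Ico (j + 1) (d + 1) := by
    grind
  have hdisj : Disjoint (Finset.range j) (Finset.Ico (j + 1) (d + 1)) := by
    grind [Finset.disjoint_left]
  rw [hsplit, Finset.prod_union hdisj]
  congr 1
  · rw [← Finset.prod_range_add_one_eq_factorial, ← Finset.prod_range_reflect, Nat.cast_prod]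
    refine Finset.prod_congr rfl fun i hi => ?_
    have hi' := Finset.mem_range.1 hi
    rw [← Nat.cast_sub (by omega), Nat.abs_cast]
    congr 1
    omega
  · rw [Finset.prod_Ico_eq_prod_range, ← Finset.prod_range_add_one_eq_factorial, Nat.cast_prod,
      Nat.add_sub_add_right]
    refine Finset.prod_congr rfl fun i _ => ?_
    rw [abs_sub_comm, add_right_comm, add_assoc, Nat.cast_add, add_sub_cancel_left, Nat.abs_cast]

lemma pow_self_sq_le (d : ℕ) : ((d : ℝ) ^ d) ^ 2 ≤ 2 ^ (d ^ 2) * (d.factorial : ℝ) ^ 2 := by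
  induction d with
  | zero => simp
  | succ d ih =>
    have hstep : (((d : ℝ) + 1) ^ d) ^ 2 ≤ 2 ^ (2 * d + 1) * ((d : ℝ) ^ d) ^ 2 := by
      rcases Nat.eq_zero_or_pos d with rfl | hd
      · norm_num
      have hd1 : (d : ℝ) + 1 ≤ 2 * d := by
        linarith [(Nat.one_le_cast (α := ℝ)).2 hd]
      calc (((d : ℝ) + 1) ^ d) ^ 2 ≤ ((2 * (d : ℝ)) ^ d) ^ 2 := by gcongr
        _ = 2 ^ (2 * d) * ((d : ℝ) ^ d) ^ 2 := by ring
        _ ≤ 2 ^ (2 * d + 1) * ((d : ℝ) ^ d) ^ 2 := by gcongr <;> norm_num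
    push_cast [Nat.factorial_succ]
    calc (((d : ℝ) + 1) ^ (d + 1)) ^ 2 = (d + 1) ^ 2 * (((d : ℝ) + 1) ^ d) ^ 2 := by ring
      _ ≤ (d + 1) ^ 2 * (2 ^ (2 * d + 1) * (2 ^ (d ^ 2) * (d.factorial : ℝ) ^ 2)) := by
        grw [hstep, ih]
      _ = 2 ^ ((d + 1) ^ 2) * (((d : ℝ) + 1) * d.factorial) ^ 2 := by ring

lemma pow_self_div_factorial_le (d : ℕ) :
    (d : ℝ) ^ d / d.factorial ≤ 2 ^ ((d : ℝ) ^ 2 / 2) := by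
  have hsq : ((2 : ℝ) ^ ((d : ℝ) ^ 2 / 2)) ^ 2 = 2 ^ (d ^ 2) := by
    rw [← Real.rpow_mul_natCast zero_le_two, Nat.cast_ofNat, div_mul_cancel₀ _ two_ne_zero,
      ← Nat.cast_pow, Real.rpow_natCast]
  rw [div_le_iff₀ (Nat.cast_pos.2 d.factorial_pos),
    ← pow_le_pow_iff_left₀ (by positivity) (by positivity) two_ne_zero, mul_pow, hsq]
  exact pow_self_sq_le d

/-- The `d + 1` equally spaced nodes `ρ j / d` of `[0, ρ]`, `0 ≤ j ≤ d`. For `d = 0` the convention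
`0 / 0 = 0` makes `0` the only node. -/
noncomputable def equispacedNode (d : ℕ) (ρ : ℝ) (j : ℕ) : ℝ := ρ * j / d

lemma equispacedNode_nonneg (hρ : 0 ≤ ρ) : 0 ≤ equispacedNode d ρ j := by
  unfold equispacedNode
  positivity

lemma equispacedNode_le (hρ : 0 ≤ ρ) (hj : j ≤ d) : equispacedNode d ρ j ≤ ρ :=
  div_le_of_le_mul₀ d.cast_nonneg hρ (mul_le_mul_of_nonneg_left (Nat.cast_le.2 hj) hρ)

lemma injOn_equispacedNode (d : ℕ) (hρ : 0 < ρ) :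
    Set.InjOn (equispacedNode d ρ) (Finset.range (d + 1)) := by
  intro i hi j hj hij
  rcases Nat.eq_zero_or_pos d with rfl | hd
  · simp_all
  · rw [equispacedNode, equispacedNode, div_left_inj' (Nat.cast_pos.2 hd).ne',
      mul_right_inj' hρ.ne'] at hij
    exact_mod_cast hij

/-- The weight of the `j`th equally spaced node of `[0, ρ]` in the Lagrange extrapolation of a
polynomial of degree at most `d` to the point `1`. -/
noncomputable def extrapolationWeight (d : ℕ) (ρ : ℝ) (j : ℕ) : ℝ :=
  (Lagrange.basis (Finset.range (d + 1)) (equispacedNode d ρ) j).eval 1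

lemma eval_one_eq_sum_extrapolationWeight (hρ : 0 < ρ) {f : Polynomial ℝ} (hf : f.natDegree ≤ d) :
    f.eval 1 =
      ∑ j ∈ Finset.range (d + 1), extrapolationWeight d ρ j * f.eval (equispacedNode d ρ j) := by
  have hdeg : f.degree < ((Finset.range (d + 1)).card : WithBot ℕ) := by
    rw [Finset.card_range]
    exact Polynomial.degree_lt_iff_coeff_zero _ _ |>.2 fun m hm =>
      Polynomial.coeff_eq_zero_of_natDegree_lt (by omega)
  conv_lhs => rw [Lagrange.eq_interpolate (injOn_equispacedNode d hρ) hdeg,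
    Lagrange.interpolate_apply]
  simp [Polynomial.eval_finsetSum, extrapolationWeight, mul_comm]

lemma abs_eval_one_basisDivisor_le (hρ : 0 < ρ) (hρ1 : ρ ≤ 1) {i : ℕ} (hi : i ≤ d) :
    |(Lagrange.basisDivisor (equispacedNode d ρ j) (equispacedNode d ρ i)).eval 1| ≤
      d / ρ * |(j : ℝ) - i|⁻¹ := by
  have hnode : |1 - equispacedNode d ρ i| ≤ 1 := by
    rw [abs_le]
    constructor <;>
    linarith [equispacedNode_nonneg (d := d) (j := i) hρ.le, equispacedNode_le hρ.le hi]
  have hdiff : |equispacedNode d ρ j - equispacedNode d ρ i| = ρ / d * |(j : ℝ) - i| := by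
    rw [← abs_of_nonneg (div_nonneg hρ.le d.cast_nonneg), ← abs_mul, equispacedNode,
      equispacedNode]
    ring_nf
  simp only [Lagrange.basisDivisor, Polynomial.eval_mul, Polynomial.eval_C, Polynomial.eval_sub,
    Polynomial.eval_X]
  rw [abs_mul, abs_inv, hdiff, mul_inv, inv_div]
  exact mul_le_of_le_one_right (by positivity) hnode

lemma abs_extrapolationWeight_le (hρ : 0 < ρ) (hρ1 : ρ ≤ 1) (hj : j ≤ d) :
    |extrapolationWeight d ρ j| ≤ (d / ρ) ^ d * ((d.choose j : ℝ) / d.factorial) := by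
  have hcard : ((Finset.range (d + 1)).erase j).card = d := by
    rw [Finset.card_erase_of_mem (Finset.mem_range_succ_iff.2 hj), Finset.card_range,
      Nat.add_one_sub_one]
  have hchoose : (d.choose j : ℝ) / d.factorial = ((j.factorial : ℝ) * (d - j).factorial)⁻¹ := by
    rw [Nat.cast_choose ℝ hj, div_div_cancel_left' (by positivity)]
  rw [extrapolationWeight, Lagrange.basis, Polynomial.eval_prod, Finset.abs_prod]
  calc ∏ i ∈ (Finset.range (d + 1)).erase j,
        |(Lagrange.basisDivisor (equispacedNode d ρ j) (equispacedNode d ρ i)).eval 1|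
      ≤ ∏ i ∈ (Finset.range (d + 1)).erase j, d / ρ * |(j : ℝ) - i|⁻¹ :=
        Finset.prod_le_prod (fun _ _ => abs_nonneg _) fun i hi =>
          abs_eval_one_basisDivisor_le hρ hρ1
            (Finset.mem_range_succ_iff.1 (Finset.mem_of_mem_erase hi))
    _ = (d / ρ) ^ d * ((d.choose j : ℝ) / d.factorial) := by
        rw [Finset.prod_mul_distrib, Finset.prod_const, hcard, Finset.prod_inv_distrib,
          prod_erase_abs_sub hj, hchoose]

lemma sum_abs_extrapolationWeight_le (d : ℕ) (hρ : 0 < ρ) (hρ1 : ρ ≤ 1) :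
    ∑ j ∈ Finset.range (d + 1), |extrapolationWeight d ρ j| ≤
      2 ^ ((d : ℝ) ^ 2 / 2 + d) * (ρ ^ d)⁻¹ :=
  calc ∑ j ∈ Finset.range (d + 1), |extrapolationWeight d ρ j|
      ≤ ∑ j ∈ Finset.range (d + 1), (d / ρ) ^ d * ((d.choose j : ℝ) / d.factorial) :=
        Finset.sum_le_sum fun j hj =>
          abs_extrapolationWeight_le hρ hρ1 (Finset.mem_range_succ_iff.1 hj)
    _ = (d / ρ) ^ d * (2 ^ d / d.factorial) := by
        rw [← Finset.mul_sum, ← Finset.sum_div, ← Nat.cast_sum, Nat.sum_range_choose, Nat.cast_pow,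
          Nat.cast_ofNat]
    _ = (d : ℝ) ^ d / d.factorial * 2 ^ d * (ρ ^ d)⁻¹ := by
        rw [div_pow]
        ring
    _ ≤ 2 ^ ((d : ℝ) ^ 2 / 2) * 2 ^ d * (ρ ^ d)⁻¹ := by
        gcongr
        exact pow_self_div_factorial_le d
    _ = 2 ^ ((d : ℝ) ^ 2 / 2 + d) * (ρ ^ d)⁻¹ := by
        rw [Real.rpow_add zero_lt_two, Real.rpow_natCast]

end Extrapolation

section OrnsteinUhlenbeck

variable {n d : ℕ} {p r t : ℝ}

/-- The Ornstein–Uhlenbeck average of a nonnegative function with correlation `t ∈ [0, 1]`, written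
by Mehler's formula. In semigroup notation `t` is `exp (-s)`. -/
noncomputable def ornsteinUhlenbeck (t : ℝ) (M : (Fin n → ℝ) → ℝ≥0∞) (x : Fin n → ℝ) : ℝ≥0∞ :=
  ∫⁻ z, M (t • x + √(1 - t ^ 2) • z) ∂stdGaussianPi n

lemma measurable_ornsteinUhlenbeck {M : (Fin n → ℝ) → ℝ≥0∞} (hM : Measurable M) (t : ℝ) :
    Measurable (ornsteinUhlenbeck t M) :=
  (hM.comp (by fun_prop : Measurable fun y : (Fin n → ℝ) × (Fin n → ℝ) =>
    t • y.1 + √(1 - t ^ 2) • y.2)).lintegral_prod_right'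

lemma eLpNorm_ennreal_eq_lintegral {α : Type*} [MeasurableSpace α] {μ : Measure α} (hp : 0 < p)
    (f : α → ℝ≥0∞) : eLpNorm f (ENNReal.ofReal p) μ = (∫⁻ x, f x ^ p ∂μ) ^ (1 / p) := by
  rw [eLpNorm_eq_lintegral_rpow_enorm_toReal (ENNReal.ofReal_pos.2 hp).ne' ENNReal.ofReal_ne_top,
    ENNReal.toReal_ofReal hp.le]
  simp only [enorm_eq_self]

theorem eLpNorm_ornsteinUhlenbeck_le (hp : 1 < p) (hr : 1 < r) (ht1 : t ^ 2 ≤ 1)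
    (ht : t ^ 2 ≤ (p - 1) / (r - 1)) {M : (Fin n → ℝ) → ℝ≥0∞} (hM : Measurable M) :
    eLpNorm (ornsteinUhlenbeck t M) (ENNReal.ofReal r) (stdGaussianPi n) ≤
      eLpNorm M (ENNReal.ofReal p) (stdGaussianPi n) := by
  rw [eLpNorm_ennreal_eq_lintegral (one_pos.trans hr),
    eLpNorm_ennreal_eq_lintegral (one_pos.trans hp)]
  exact gaussian_hypercontractivity hp hr
    (by rw [Real.sq_sqrt (sub_nonneg.2 ht1), add_sub_cancel]) ht hM

lemma integrable_add_const_mul_pow_gaussianReal (c s : ℝ) (k : ℕ) :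
    Integrable (fun z : ℝ => (c + s * z) ^ k) (gaussianReal 0 1) := by
  have h : MemLp (fun z : ℝ => c + s * z) k (gaussianReal 0 1) :=
    (memLp_const c).add ((memLp_id_gaussianReal' (k : ℝ≥0∞) (ENNReal.natCast_ne_top k)).const_mul s)
  simpa only [norm_pow] using (integrable_norm_iff (by fun_prop)).1 (by
    simpa only [norm_pow] using h.integrable_norm_pow')

lemma integral_pow_gaussianReal_of_odd {l : ℕ} (hl : Odd l) :
    ∫ z, z ^ l ∂(gaussianReal 0 1) = 0 := by
  have h : ∫ z, z ^ l ∂(gaussianReal 0 1) = ∫ z, (-z) ^ l ∂(gaussianReal 0 1) := by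
    conv_lhs => rw [← neg_zero, ← gaussianReal_map_neg, integral_map (by fun_prop) (by fun_prop)]
  rwa [funext fun z => hl.neg_pow z, integral_neg, self_eq_neg] at h

lemma integral_const_mul_pow_gaussianReal (s : ℝ) (l : ℕ) :
    ∫ z, (s * z) ^ l ∂(gaussianReal 0 1) =
      (∫ z, z ^ l ∂(gaussianReal 0 1)) * (s ^ 2) ^ (l / 2) := by
  simp only [mul_pow]
  rw [integral_const_mul, mul_comm]
  rcases Nat.even_or_odd l with hl | hl
  · rw [← pow_mul, Nat.mul_div_cancel' hl.two_dvd]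
  · rw [integral_pow_gaussianReal_of_odd hl, zero_mul, zero_mul]

/-- The polynomial `t ↦ E[(t x + √(1 - t²) Z)^k]` for a standard Gaussian `Z`, which is the
Ornstein–Uhlenbeck average of a monomial as a function of the correlation `t ∈ [0, 1]`. -/
noncomputable def mehlerPolynomial (x : ℝ) (k : ℕ) : Polynomial ℝ :=
  ∑ j ∈ Finset.range (k + 1),
    Polynomial.C (x ^ j * (∫ z, z ^ (k - j) ∂(gaussianReal 0 1)) * k.choose j) *
      (Polynomial.X ^ j * (1 - Polynomial.X ^ 2) ^ ((k - j) / 2))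

lemma natDegree_mehlerPolynomial_le (x : ℝ) (k : ℕ) : (mehlerPolynomial x k).natDegree ≤ k := by
  refine Polynomial.natDegree_sum_le_of_forall_le _ _ fun j hj => ?_
  have hj' := Finset.mem_range.1 hj
  have hquad : (1 - Polynomial.X ^ 2 : Polynomial ℝ).natDegree ≤ 2 := by compute_degree
  have hpow := Polynomial.natDegree_mul_le_of_le (Polynomial.natDegree_X_pow_le (R := ℝ) j)
    (Polynomial.natDegree_pow_le_of_le ((k - j) / 2) hquad)
  exact (Polynomial.natDegree_C_mul_le _ _).trans (hpow.trans (by omega))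

lemma eval_mehlerPolynomial (x : ℝ) (k : ℕ) (ht : t ^ 2 ≤ 1) :
    (mehlerPolynomial x k).eval t =
      ∫ z, (t * x + √(1 - t ^ 2) * z) ^ k ∂(gaussianReal 0 1) := by
  simp only [add_pow]
  rw [integral_finsetSum, mehlerPolynomial, Polynomial.eval_finsetSum]
  · refine Finset.sum_congr rfl fun j _ => ?_
    rw [integral_mul_const, integral_const_mul, integral_const_mul_pow_gaussianReal,
      Real.sq_sqrt (sub_nonneg.2 ht)]
    simp only [Polynomial.eval_mul, Polynomial.eval_C, Polynomial.eval_pow, Polynomial.eval_X,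
      Polynomial.eval_sub, Polynomial.eval_one]
    ring
  · intro j _
    refine (Integrable.const_mul ?_ _).mul_const _
    simpa only [zero_add] using
      integrable_add_const_mul_pow_gaussianReal 0 (√(1 - t ^ 2)) (k - j)

lemma exists_natDegree_le_integral_eval_eq {Q : MvPolynomial (Fin n) ℝ} (hQ : Q.totalDegree ≤ d)
    (x : Fin n → ℝ) :
    ∃ q : Polynomial ℝ, q.natDegree ≤ d ∧ ∀ t : ℝ, t ^ 2 ≤ 1 →
      ∫ z, MvPolynomial.eval (t • x + √(1 - t ^ 2) • z) Q ∂stdGaussianPi n = q.eval t := by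
  refine ⟨∑ m ∈ Q.support, Polynomial.C (Q.coeff m) * ∏ i, mehlerPolynomial (x i) (m i), ?_,
    fun t ht => ?_⟩
  · refine Polynomial.natDegree_sum_le_of_forall_le _ _ fun m hm => ?_
    calc (Polynomial.C (Q.coeff m) * ∏ i, mehlerPolynomial (x i) (m i)).natDegree
        ≤ ∑ i, (mehlerPolynomial (x i) (m i)).natDegree :=
          (Polynomial.natDegree_C_mul_le _ _).trans (Polynomial.natDegree_prod_le _ _)
      _ ≤ ∑ i, m i := Finset.sum_le_sum fun i _ => natDegree_mehlerPolynomial_le _ _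
      _ = m.sum fun _ e => e := (Finsupp.sum_fintype m (fun _ e => e) fun _ => rfl).symm
      _ ≤ d := (MvPolynomial.le_totalDegree hm).trans hQ
  · simp only [MvPolynomial.eval_eq', Pi.add_apply, Pi.smul_apply, smul_eq_mul]
    rw [integral_finsetSum, Polynomial.eval_finsetSum]
    · refine Finset.sum_congr rfl fun m _ => ?_
      rw [integral_const_mul, Polynomial.eval_mul, Polynomial.eval_C, Polynomial.eval_prod,
        integral_fintype_prod_eq_prod (f := fun i z => (t * x i + √(1 - t ^ 2) * z) ^ m i)]
      simp only [eval_mehlerPolynomial _ _ ht]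
    · intro m _
      exact (Integrable.fintype_prod (f := fun i z => (t * x i + √(1 - t ^ 2) * z) ^ m i)
        fun i => integrable_add_const_mul_pow_gaussianReal _ _ _).const_mul _

end OrnsteinUhlenbeck

section PolynomialComparison

variable {n d : ℕ} {p r : ℝ} {ι : Type*} {Q : ι → MvPolynomial (Fin n) ℝ}

/-- The constant `2^(d²/2 + d) ((r - 1) / (p - 1))^(d/2)` of the moment comparison. -/
noncomputable def chaosConst (d : ℕ) (p r : ℝ) : ℝ :=
  (2 : ℝ) ^ ((d : ℝ) ^ 2 / 2 + d) * ((r - 1) / (p - 1)) ^ ((d : ℝ) / 2)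

lemma chaosConst_eq_mul_inv_pow (d : ℕ) (hp : 1 < p) (hr : 1 < r) :
    chaosConst d p r = 2 ^ ((d : ℝ) ^ 2 / 2 + d) * (√((p - 1) / (r - 1)) ^ d)⁻¹ := by
  have hq : 0 ≤ (p - 1) / (r - 1) := (div_pos (sub_pos.2 hp) (sub_pos.2 hr)).le
  rw [chaosConst, Real.sqrt_eq_rpow, ← Real.rpow_mul_natCast hq, ← Real.inv_rpow hq, inv_div,
    one_div_mul_eq_div]

lemma enorm_eval_le_sum_ornsteinUhlenbeck {ρ : ℝ} (hρ : 0 < ρ) (hρ1 : ρ ≤ 1)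
    (hQ : ∀ i, (Q i).totalDegree ≤ d) (x : Fin n → ℝ) :
    ⨆ i, ‖MvPolynomial.eval x (Q i)‖ₑ ≤
      ∑ j ∈ Finset.range (d + 1), ‖extrapolationWeight d ρ j‖ₑ *
        ornsteinUhlenbeck (equispacedNode d ρ j)
          (fun y => ⨆ i, ‖MvPolynomial.eval y (Q i)‖ₑ) x := by
  refine iSup_le fun i => ?_
  obtain ⟨q, hqd, hq⟩ := exists_natDegree_le_integral_eval_eq (hQ i) x
  have hq1 : MvPolynomial.eval x (Q i) = q.eval 1 := by
    rw [← hq 1 (one_pow 2).le]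
    simp
  rw [hq1, eval_one_eq_sum_extrapolationWeight hρ hqd]
  refine (enorm_sum_le _ _).trans (Finset.sum_le_sum fun j hj => ?_)
  have hnode := pow_le_one₀ (n := 2) (equispacedNode_nonneg (d := d) (j := j) hρ.le)
    ((equispacedNode_le hρ.le (Finset.mem_range_succ_iff.1 hj)).trans hρ1)
  rw [enorm_mul, ← hq _ hnode]
  gcongr
  exact (enorm_integral_le_lintegral_enorm _).trans
    (lintegral_mono fun z => le_iSup (fun i => ‖MvPolynomial.eval _ (Q i)‖ₑ) i)

lemma eLpNorm_le_ofReal_sum_abs_mul {α κ : Type*} [MeasurableSpace α] {μ : Measure α}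
    {s : Finset κ} {w : κ → ℝ} {M : α → ℝ≥0∞} {S : κ → α → ℝ≥0∞} {q C : ℝ≥0∞} (hq : 1 ≤ q)
    (hS : ∀ j, Measurable (S j)) (hM : ∀ x, M x ≤ ∑ j ∈ s, ‖w j‖ₑ * S j x)
    (hC : ∀ j ∈ s, eLpNorm (S j) q μ ≤ C) :
    eLpNorm M q μ ≤ ENNReal.ofReal (∑ j ∈ s, |w j|) * C :=
  calc eLpNorm M q μ ≤ eLpNorm (∑ j ∈ s, fun x => ‖w j‖ₑ * S j x) q μ :=
        eLpNorm_mono_enorm fun x => by simpa using hM x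
    _ ≤ ∑ j ∈ s, eLpNorm (fun x => ‖w j‖ₑ * S j x) q μ :=
        eLpNorm_sum_le (fun j _ => ((hS j).const_mul _).aestronglyMeasurable) hq
    _ ≤ ∑ j ∈ s, ‖w j‖ₑ * C :=
        Finset.sum_le_sum fun j hj => (eLpNorm_le_nnreal_smul_eLpNorm_of_ae_le_mul'
          (ae_of_all _ fun x => le_rfl) _).trans (mul_le_mul_right (hC j hj) _)
    _ = ENNReal.ofReal (∑ j ∈ s, |w j|) * C := by
        simp only [← Finset.sum_mul, ENNReal.ofReal_sum_of_nonneg fun _ _ => abs_nonneg _,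
          Real.enorm_eq_ofReal_abs]

theorem eLpNorm_iSup_eval_le [Countable ι] (hQ : ∀ i, (Q i).totalDegree ≤ d) (hp : 1 < p)
    (hpr : p < r) :
    eLpNorm (fun x => ⨆ i, ‖MvPolynomial.eval x (Q i)‖ₑ) (ENNReal.ofReal r) (stdGaussianPi n) ≤
      ENNReal.ofReal (chaosConst d p r) *
        eLpNorm (fun x => ⨆ i, ‖MvPolynomial.eval x (Q i)‖ₑ) (ENNReal.ofReal p)
          (stdGaussianPi n) := by
  have hr : 1 < r := hp.trans hpr
  have hM : Measurable fun x : Fin n → ℝ => ⨆ i, ‖MvPolynomial.eval x (Q i)‖ₑ :=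
    .iSup fun i => (MvPolynomial.continuous_eval (Q i)).measurable.enorm
  set ρ := √((p - 1) / (r - 1))
  have hq : 0 < (p - 1) / (r - 1) := div_pos (sub_pos.2 hp) (sub_pos.2 hr)
  have hρ : 0 < ρ := Real.sqrt_pos.2 hq
  have hρ1 : ρ ≤ 1 :=
    Real.sqrt_le_one.2 ((div_le_one (sub_pos.2 hr)).2 (sub_le_sub_right hpr.le 1))
  refine (eLpNorm_le_ofReal_sum_abs_mul (ENNReal.one_le_ofReal.2 hr.le)
    (fun j => measurable_ornsteinUhlenbeck hM (equispacedNode d ρ j))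
    (fun x => enorm_eval_le_sum_ornsteinUhlenbeck hρ hρ1 hQ x) fun j hj => ?_).trans
    (mul_le_mul_left (ENNReal.ofReal_le_ofReal ?_) _)
  · have hnode := pow_le_pow_left₀ (equispacedNode_nonneg hρ.le)
      (equispacedNode_le hρ.le (Finset.mem_range_succ_iff.1 hj)) 2
    exact eLpNorm_ornsteinUhlenbeck_le hp hr (hnode.trans (pow_le_one₀ hρ.le hρ1))
      (hnode.trans_eq (Real.sq_sqrt hq.le)) hM
  · rw [chaosConst_eq_mul_inv_pow d hp hr]
    exact sum_abs_extrapolationWeight_le d hρ hρ1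

end PolynomialComparison

/-- All `L^r` norms of `M` with `r > 1` are finite and comparable, with the constants `chaosConst`
of a Gaussian chaos of degree `d`. -/
def MomentComparison {Ω : Type*} [MeasurableSpace Ω] (P : Measure Ω) (d : ℕ) (M : Ω → ℝ≥0∞) :
    Prop :=
  ∀ p r : ℝ, 1 < p → p < r →
    eLpNorm M (ENNReal.ofReal r) P ≤
      ENNReal.ofReal (chaosConst d p r) * eLpNorm M (ENNReal.ofReal p) P ∧
    eLpNorm M (ENNReal.ofReal p) P < ∞

section MomentComparison

variable {Ω : Type*} [MeasurableSpace Ω] {P : Measure Ω} {p s : ℝ} {M : Ω → ℝ≥0∞}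
  {Mk : ℕ → Ω → ℝ≥0∞}

lemma eLpNorm_ennreal_le_iff (hp : 0 < p) {C : ℝ≥0∞} :
    eLpNorm M (ENNReal.ofReal p) P ≤ C ↔ ∫⁻ ω, M ω ^ p ∂P ≤ C ^ p := by
  rw [eLpNorm_ennreal_eq_lintegral hp, one_div, ENNReal.rpow_inv_le_iff hp]

lemma lintegral_rpow_ne_top_of_eLpNorm_lt_top (hp : 0 < p)
    (h : eLpNorm M (ENNReal.ofReal p) P < ∞) : ∫⁻ ω, M ω ^ p ∂P ≠ ∞ :=
  ((eLpNorm_ennreal_le_iff hp).1 le_rfl).trans_lt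
    (ENNReal.rpow_lt_top_of_nonneg hp.le h.ne) |>.ne

lemma rpow_two_le_add_mul_min (x L : ℝ≥0∞) :
    x ^ (2 : ℝ) ≤ L ^ (2 : ℝ) + x ^ (2 : ℝ) * min (x / L) 1 ^ (1 / 2 : ℝ) := by
  rcases le_or_gt x L with hx | hx
  · exact (ENNReal.rpow_le_rpow hx zero_le_two).trans le_self_add
  · have h1 : 1 ≤ x / L := by
      rw [ENNReal.le_div_iff_mul_le (Or.inr hx.ne_bot) (Or.inl hx.ne_top), one_mul]
      exact hx.le
    rw [min_eq_right h1, ENNReal.one_rpow, mul_one]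
    exact le_add_self

/- The Paley–Zygmund argument: `E M²` is at most `L²` plus the contribution of `{M > L}`, which
the Cauchy–Schwarz inequality and the bound on `E M⁴` absorb into the left-hand side. -/
lemma lintegral_rpow_two_le_of_small_tail [IsProbabilityMeasure P] (hM : AEMeasurable M P)
    {K L : ℝ≥0∞} (hfin : ∫⁻ ω, M ω ^ (2 : ℝ) ∂P ≠ ∞)
    (h4 : (∫⁻ ω, M ω ^ (4 : ℝ) ∂P) ^ (1 / 2 : ℝ) ≤ K * ∫⁻ ω, M ω ^ (2 : ℝ) ∂P)
    (hK : K * (∫⁻ ω, min (M ω / L) 1 ∂P) ^ (1 / 2 : ℝ) ≤ 1 / 2) :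
    ∫⁻ ω, M ω ^ (2 : ℝ) ∂P ≤ 2 * L ^ (2 : ℝ) := by
  set A := ∫⁻ ω, M ω ^ (2 : ℝ) ∂P
  have htail : ∫⁻ ω, M ω ^ (2 : ℝ) * min (M ω / L) 1 ^ (1 / 2 : ℝ) ∂P ≤ A / 2 :=
    calc ∫⁻ ω, M ω ^ (2 : ℝ) * min (M ω / L) 1 ^ (1 / 2 : ℝ) ∂P
        ≤ (∫⁻ ω, (M ω ^ (2 : ℝ)) ^ (2 : ℝ) ∂P) ^ (1 / 2 : ℝ) *
            (∫⁻ ω, (min (M ω / L) 1 ^ (1 / 2 : ℝ)) ^ (2 : ℝ) ∂P) ^ (1 / 2 : ℝ) :=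
          ENNReal.lintegral_mul_le_Lp_mul_Lq P Real.HolderConjugate.two_two (hM.pow_const _)
            (((hM.div_const L).min aemeasurable_const).pow_const _)
      _ = (∫⁻ ω, M ω ^ (4 : ℝ) ∂P) ^ (1 / 2 : ℝ) *
            (∫⁻ ω, min (M ω / L) 1 ∂P) ^ (1 / 2 : ℝ) := by
          simp only [← ENNReal.rpow_mul]
          norm_num
      _ ≤ K * A * (∫⁻ ω, min (M ω / L) 1 ∂P) ^ (1 / 2 : ℝ) := by gcongr
      _ = A * (K * (∫⁻ ω, min (M ω / L) 1 ∂P) ^ (1 / 2 : ℝ)) := by ring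
      _ ≤ A / 2 := by rw [div_eq_mul_one_div A 2]; gcongr
  have hhalf : A / 2 + A / 2 ≤ L ^ (2 : ℝ) + A / 2 :=
    calc A / 2 + A / 2 = A := ENNReal.add_halves A
      _ ≤ ∫⁻ ω, (L ^ (2 : ℝ) + M ω ^ (2 : ℝ) * min (M ω / L) 1 ^ (1 / 2 : ℝ)) ∂P :=
          lintegral_mono fun ω => rpow_two_le_add_mul_min (M ω) L
      _ = L ^ (2 : ℝ) + ∫⁻ ω, M ω ^ (2 : ℝ) * min (M ω / L) 1 ^ (1 / 2 : ℝ) ∂P := by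
          rw [lintegral_add_left measurable_const, lintegral_const, measure_univ, mul_one]
      _ ≤ L ^ (2 : ℝ) + A / 2 := by gcongr
  calc A = 2 * (A / 2) := (ENNReal.mul_div_cancel two_ne_zero ENNReal.ofNat_ne_top).symm
    _ ≤ 2 * L ^ (2 : ℝ) := mul_le_mul_right
        (ENNReal.le_of_add_le_add_right (ENNReal.div_ne_top hfin two_ne_zero) hhalf) 2

lemma tendsto_lintegral_comp_of_le_const [IsFiniteMeasure P] (hMk : ∀ k, AEMeasurable (Mk k) P)
    (hlim : ∀ᵐ ω ∂P, Tendsto (fun k => Mk k ω) atTop (𝓝 (M ω))) {φ : ℝ≥0∞ → ℝ≥0∞}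
    (hφ : Continuous φ) {c : ℝ≥0∞} (hc : c ≠ ∞) (hφc : ∀ x, φ x ≤ c) :
    Tendsto (fun k => ∫⁻ ω, φ (Mk k ω) ∂P) atTop (𝓝 (∫⁻ ω, φ (M ω) ∂P)) :=
  tendsto_lintegral_of_dominated_convergence' (fun _ => c)
    (fun k => hφ.measurable.comp_aemeasurable (hMk k)) (fun _ => ae_of_all _ fun _ => hφc _)
    (by simpa using ENNReal.mul_ne_top hc (measure_ne_top P _))
    (hlim.mono fun _ hω => (hφ.tendsto _).comp hω)

lemma exists_lintegral_min_div_lt [IsFiniteMeasure P] (hM : AEMeasurable M P)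
    (hfin : ∀ᵐ ω ∂P, M ω < ∞) {δ : ℝ≥0∞} (hδ : 0 < δ) :
    ∃ L : ℕ, L ≠ 0 ∧ ∫⁻ ω, min (M ω / L) 1 ∂P < δ := by
  have hlim : Tendsto (fun L : ℕ => ∫⁻ ω, min (M ω / L) 1 ∂P) atTop (𝓝 (∫⁻ _, 0 ∂P)) := by
    refine tendsto_lintegral_of_dominated_convergence' (fun _ => 1)
      (fun k => (hM.div_const _).min aemeasurable_const)
      (fun _ => ae_of_all _ fun _ => min_le_right _ _) (by simp) ?_
    filter_upwards [hfin] with ω hω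
    simpa using (ENNReal.Tendsto.const_div ENNReal.tendsto_nat_nhds_top (Or.inr hω.ne)).min
      (tendsto_const_nhds (x := (1 : ℝ≥0∞)))
  rw [lintegral_zero] at hlim
  exact ((eventually_ne_atTop 0).and (hlim.eventually_lt_const hδ)).exists

lemma exists_pos_forall_lt_const_mul_rpow_le {K : ℝ≥0∞} (hK : K ≠ ∞) (hp : 0 < p) {η : ℝ≥0∞}
    (hη : 0 < η) : ∃ δ, 0 < δ ∧ ∀ x < δ, K * x ^ p ≤ η := by
  have hlim : Tendsto (fun x : ℝ≥0∞ => K * x ^ p) (𝓝 0) (𝓝 0) := by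
    simpa only [ENNReal.zero_rpow_of_pos hp, mul_zero, id_eq] using
      ENNReal.Tendsto.const_mul (tendsto_id.ennrpow_const p (a := 0)) (Or.inr hK)
  obtain ⟨δ, hδ, h⟩ := ENNReal.nhds_zero_basis.eventually_iff.1 (hlim.eventually_lt_const hη)
  exact ⟨δ, hδ, fun x hx => (h hx).le⟩

lemma exists_eventually_lintegral_rpow_two_le [IsProbabilityMeasure P]
    (hMk : ∀ k, AEMeasurable (Mk k) P)
    (hlim : ∀ᵐ ω ∂P, Tendsto (fun k => Mk k ω) atTop (𝓝 (M ω))) (hfin : ∀ᵐ ω ∂P, M ω < ∞)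
    {K : ℝ≥0∞} (hK : K ≠ ∞) (h2 : ∀ k, ∫⁻ ω, Mk k ω ^ (2 : ℝ) ∂P ≠ ∞)
    (h4 : ∀ k, (∫⁻ ω, Mk k ω ^ (4 : ℝ) ∂P) ^ (1 / 2 : ℝ) ≤ K * ∫⁻ ω, Mk k ω ^ (2 : ℝ) ∂P) :
    ∃ B ≠ ∞, ∀ᶠ k in atTop, ∫⁻ ω, Mk k ω ^ (2 : ℝ) ∂P ≤ B := by
  obtain ⟨δ, hδ, hδK⟩ := exists_pos_forall_lt_const_mul_rpow_le hK one_half_pos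
    (ENNReal.half_pos one_ne_zero)
  obtain ⟨L, hL0, hL⟩ := exists_lintegral_min_div_lt
    (aemeasurable_of_tendsto_metrizable_ae atTop hMk hlim) hfin hδ
  have hcont : Continuous fun x : ℝ≥0∞ => min (x / L) 1 :=
    (ENNReal.continuous_div_const _ (Nat.cast_ne_zero.2 hL0)).min continuous_const
  have htail := (tendsto_lintegral_comp_of_le_const hMk hlim hcont ENNReal.one_ne_top
    fun x => min_le_right _ _).eventually_lt_const hL
  refine ⟨2 * (L : ℝ≥0∞) ^ (2 : ℝ), by finiteness, htail.mono fun k hk => ?_⟩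
  exact lintegral_rpow_two_le_of_small_tail (hMk k) (h2 k) (h4 k) (hδK _ hk)

lemma rpow_le_min_rpow_add (hp : 0 < p) (hps : p < s) (x : ℝ≥0∞) {L : ℝ≥0∞} (hL0 : L ≠ 0)
    (hL : L ≠ ∞) : x ^ p ≤ min x L ^ p + L⁻¹ ^ (s - p) * x ^ s := by
  rcases le_or_gt x L with hx | hx
  · rw [min_eq_left hx]
    exact le_self_add
  refine le_trans ?_ le_add_self
  have hsp : 0 < s - p := sub_pos.2 hps
  rcases eq_or_ne x ∞ with rfl | hxtop
  · rw [ENNReal.top_rpow_of_pos (hp.trans hps), ENNReal.mul_top]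
    · exact le_top
    · simp [ENNReal.rpow_eq_zero_iff, hL, hps.le]
  · calc x ^ p = x ^ p * (L⁻¹ ^ (s - p) * L ^ (s - p)) := by
          rw [← ENNReal.mul_rpow_of_nonneg _ _ hsp.le, ENNReal.inv_mul_cancel hL0 hL,
            ENNReal.one_rpow, mul_one]
      _ ≤ x ^ p * (L⁻¹ ^ (s - p) * x ^ (s - p)) := by gcongr
      _ = L⁻¹ ^ (s - p) * (x ^ (s - p) * x ^ p) := by ring
      _ = L⁻¹ ^ (s - p) * x ^ s := by
          rw [← ENNReal.rpow_add _ _ hx.ne_bot hxtop, sub_add_cancel]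

lemma limsup_lintegral_rpow_le [IsFiniteMeasure P] (hp : 0 < p) (hps : p < s)
    (hMk : ∀ k, AEMeasurable (Mk k) P)
    (hlim : ∀ᵐ ω ∂P, Tendsto (fun k => Mk k ω) atTop (𝓝 (M ω))) {B : ℝ≥0∞}
    (hBk : ∀ᶠ k in atTop, ∫⁻ ω, Mk k ω ^ s ∂P ≤ B) {L : ℕ} (hL : L ≠ 0) :
    limsup (fun k => ∫⁻ ω, Mk k ω ^ p ∂P) atTop ≤
      ∫⁻ ω, M ω ^ p ∂P + (L : ℝ≥0∞)⁻¹ ^ (s - p) * B := by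
  have htrunc : Tendsto (fun k => ∫⁻ ω, min (Mk k ω) L ^ p ∂P) atTop
      (𝓝 (∫⁻ ω, min (M ω) L ^ p ∂P)) :=
    tendsto_lintegral_comp_of_le_const hMk hlim
      (ENNReal.continuous_rpow_const.comp (continuous_id.min continuous_const))
      (ENNReal.rpow_ne_top_of_nonneg hp.le (ENNReal.natCast_ne_top L))
      fun x => ENNReal.rpow_le_rpow (min_le_right _ _) hp.le
  have hle : ∀ᶠ k in atTop, ∫⁻ ω, Mk k ω ^ p ∂P ≤
      ∫⁻ ω, min (Mk k ω) L ^ p ∂P + (L : ℝ≥0∞)⁻¹ ^ (s - p) * B := by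
    filter_upwards [hBk] with k hk
    calc ∫⁻ ω, Mk k ω ^ p ∂P
        ≤ ∫⁻ ω, (min (Mk k ω) L ^ p + (L : ℝ≥0∞)⁻¹ ^ (s - p) * Mk k ω ^ s) ∂P :=
          lintegral_mono fun ω => rpow_le_min_rpow_add hp hps _ (Nat.cast_ne_zero.2 hL)
            (ENNReal.natCast_ne_top L)
      _ = ∫⁻ ω, min (Mk k ω) L ^ p ∂P + (L : ℝ≥0∞)⁻¹ ^ (s - p) * ∫⁻ ω, Mk k ω ^ s ∂P := by
          rw [lintegral_add_left' (((hMk k).min aemeasurable_const).pow_const p),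
            lintegral_const_mul'' _ ((hMk k).pow_const s)]
      _ ≤ ∫⁻ ω, min (Mk k ω) L ^ p ∂P + (L : ℝ≥0∞)⁻¹ ^ (s - p) * B := by gcongr
  calc limsup (fun k => ∫⁻ ω, Mk k ω ^ p ∂P) atTop
      ≤ limsup (fun k => ∫⁻ ω, min (Mk k ω) L ^ p ∂P + (L : ℝ≥0∞)⁻¹ ^ (s - p) * B) atTop :=
        limsup_le_limsup hle
    _ = ∫⁻ ω, min (M ω) L ^ p ∂P + (L : ℝ≥0∞)⁻¹ ^ (s - p) * B :=
        (htrunc.add_const _).limsup_eq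
    _ ≤ ∫⁻ ω, M ω ^ p ∂P + (L : ℝ≥0∞)⁻¹ ^ (s - p) * B := by
        gcongr
        exact min_le_left _ _

lemma tendsto_lintegral_rpow_of_tendsto_ae [IsFiniteMeasure P] (hp : 0 < p) (hps : p < s)
    (hMk : ∀ k, AEMeasurable (Mk k) P)
    (hlim : ∀ᵐ ω ∂P, Tendsto (fun k => Mk k ω) atTop (𝓝 (M ω))) {B : ℝ≥0∞} (hB : B ≠ ∞)
    (hBk : ∀ᶠ k in atTop, ∫⁻ ω, Mk k ω ^ s ∂P ≤ B) :
    Tendsto (fun k => ∫⁻ ω, Mk k ω ^ p ∂P) atTop (𝓝 (∫⁻ ω, M ω ^ p ∂P)) := by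
  refine tendsto_of_le_liminf_of_limsup_le ?_ ?_
  · calc ∫⁻ ω, M ω ^ p ∂P = ∫⁻ ω, liminf (fun k => Mk k ω ^ p) atTop ∂P :=
          lintegral_congr_ae (hlim.mono fun ω hω => ((hω.ennrpow_const p).liminf_eq).symm)
      _ ≤ liminf (fun k => ∫⁻ ω, Mk k ω ^ p ∂P) atTop :=
          lintegral_liminf_le' fun k => (hMk k).pow_const p
  · have hzero : Tendsto (fun L : ℕ => (L : ℝ≥0∞)⁻¹ ^ (s - p) * B) atTop (𝓝 0) := by
      simpa only [ENNReal.zero_rpow_of_pos (sub_pos.2 hps), zero_mul] using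
        ENNReal.Tendsto.mul_const (ENNReal.tendsto_inv_nat_nhds_zero.ennrpow_const (s - p))
          (Or.inr hB)
    have hsum := hzero.const_add (∫⁻ ω, M ω ^ p ∂P)
    rw [add_zero] at hsum
    exact ge_of_tendsto hsum ((eventually_ne_atTop 0).mono fun L hL =>
      limsup_lintegral_rpow_le hp hps hMk hlim hBk hL)

variable {d : ℕ}

lemma MomentComparison.lintegral_rpow_four_le (h : MomentComparison P d M) :
    (∫⁻ ω, M ω ^ (4 : ℝ) ∂P) ^ (1 / 2 : ℝ) ≤
      ENNReal.ofReal (chaosConst d 2 4) ^ (2 : ℝ) * ∫⁻ ω, M ω ^ (2 : ℝ) ∂P := by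
  have h24 := (h 2 4 one_lt_two (by norm_num)).1
  rw [eLpNorm_ennreal_eq_lintegral (by norm_num), eLpNorm_ennreal_eq_lintegral two_pos] at h24
  have hsq := ENNReal.rpow_le_rpow h24 zero_le_two
  rw [ENNReal.mul_rpow_of_nonneg _ _ zero_le_two, ← ENNReal.rpow_mul, ← ENNReal.rpow_mul] at hsq
  norm_num at hsq ⊢
  exact hsq

lemma MomentComparison.exists_eventually_lintegral_rpow_le [IsProbabilityMeasure P]
    (hcomp : ∀ k, MomentComparison P d (Mk k)) (hMk : ∀ k, AEMeasurable (Mk k) P)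
    (hlim : ∀ᵐ ω ∂P, Tendsto (fun k => Mk k ω) atTop (𝓝 (M ω))) (hfin : ∀ᵐ ω ∂P, M ω < ∞)
    (hs : 2 < s) : ∃ B ≠ ∞, ∀ᶠ k in atTop, ∫⁻ ω, Mk k ω ^ s ∂P ≤ B := by
  have h2 : ∀ k, ∫⁻ ω, Mk k ω ^ (2 : ℝ) ∂P ≠ ∞ := fun k =>
    lintegral_rpow_ne_top_of_eLpNorm_lt_top two_pos (hcomp k 2 s one_lt_two hs).2
  obtain ⟨B, hB, hBk⟩ := exists_eventually_lintegral_rpow_two_le hMk hlim hfin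
    (by finiteness) h2 fun k => (hcomp k).lintegral_rpow_four_le
  have hs0 : 0 < s := two_pos.trans hs
  refine ⟨(ENNReal.ofReal (chaosConst d 2 s) * B ^ (1 / 2 : ℝ)) ^ s, by finiteness, ?_⟩
  filter_upwards [hBk] with k hk
  rw [← eLpNorm_ennreal_le_iff hs0]
  refine (hcomp k 2 s one_lt_two hs).1.trans ?_
  rw [eLpNorm_ennreal_eq_lintegral two_pos]
  gcongr

theorem MomentComparison.of_tendsto_ae [IsProbabilityMeasure P]
    (hMk : ∀ k, AEMeasurable (Mk k) P)
    (hcomp : ∀ k, MomentComparison P d (Mk k))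
    (hlim : ∀ᵐ ω ∂P, Tendsto (fun k => Mk k ω) atTop (𝓝 (M ω))) (hfin : ∀ᵐ ω ∂P, M ω < ∞) :
    MomentComparison P d M := by
  have hnorm : ∀ p : ℝ, 1 < p → Tendsto (fun k => eLpNorm (Mk k) (ENNReal.ofReal p) P) atTop
      (𝓝 (eLpNorm M (ENNReal.ofReal p) P)) := by
    intro p hp
    obtain ⟨B, hB, hBk⟩ := MomentComparison.exists_eventually_lintegral_rpow_le hcomp hMk hlim hfin
      ((le_max_right p 2).trans_lt (lt_add_one _))
    have hp0 : 0 < p := one_pos.trans hp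
    simp only [eLpNorm_ennreal_eq_lintegral hp0]
    exact (tendsto_lintegral_rpow_of_tendsto_ae hp0 ((le_max_left p 2).trans_lt (lt_add_one _))
      hMk hlim hB hBk).ennrpow_const _
  have hfinite : ∀ p : ℝ, 2 < p → eLpNorm M (ENNReal.ofReal p) P < ∞ := by
    intro p hp
    have hp0 : 0 < p := two_pos.trans hp
    obtain ⟨B, hB, hBk⟩ :=
      MomentComparison.exists_eventually_lintegral_rpow_le hcomp hMk hlim hfin hp
    refine lt_of_le_of_lt (le_of_tendsto (hnorm p (one_lt_two.trans hp)) (b := B ^ (1 / p)) ?_)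
      (ENNReal.rpow_lt_top_of_nonneg (by positivity) hB)
    filter_upwards [hBk] with k hk
    rw [eLpNorm_ennreal_eq_lintegral hp0]
    gcongr
  have hM : AEMeasurable M P := aemeasurable_of_tendsto_metrizable_ae atTop hMk hlim
  refine fun p r hp hpr => ⟨le_of_tendsto_of_tendsto' (hnorm r (hp.trans hpr))
    (ENNReal.Tendsto.const_mul (hnorm p hp) (Or.inr ENNReal.ofReal_ne_top))
    fun k => (hcomp k p r hp hpr).1, ?_⟩
  exact (eLpNorm_le_eLpNorm_of_exponent_le (ENNReal.ofReal_le_ofReal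
    ((le_max_left p 2).trans (lt_add_one _).le)) hM.aestronglyMeasurable).trans_lt
    (hfinite _ ((le_max_right p 2).trans_lt (lt_add_one _)))

end MomentComparison

section GaussianVectors

open scoped MatrixOrder Matrix

lemma exists_eq_multivariateGaussian {ι : Type*} [Fintype ι] [DecidableEq ι]
    (μ : Measure (EuclideanSpace ℝ ι)) [IsGaussian μ] :
    ∃ (m : EuclideanSpace ℝ ι) (S : Matrix ι ι ℝ), μ = multivariateGaussian m S := by
  let b := (EuclideanSpace.basisFun ι ℝ).toBasis
  let C := (covarianceBilin μ).toBilinForm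
  have hC : (LinearMap.BilinForm.toMatrix b C).PosSemidef := by
    refine .of_dotProduct_mulVec_nonneg ?_ fun x => ?_
    · ext i j
      exact covarianceBilin_comm _ _
    · exact (covarianceBilin_self_nonneg _).trans_eq
        (LinearMap.BilinForm.dotProduct_toMatrix_mulVec b C x x).symm
  refine ⟨μ[id], LinearMap.BilinForm.toMatrix b C, IsGaussian.ext ?_ ?_⟩
  · rw [integral_id_multivariateGaussian']
  · ext x y
    rw [covarianceBilin_multivariateGaussian hC]
    exact LinearMap.BilinForm.apply_eq_dotProduct_toMatrix_mulVec b C x y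

lemma exists_map_ofLp_eq_map_stdGaussianPi {n : ℕ} (μ : Measure (EuclideanSpace ℝ (Fin n)))
    [IsGaussian μ] : ∃ (m : Fin n → ℝ) (B : Matrix (Fin n) (Fin n) ℝ),
      μ.map WithLp.ofLp = (stdGaussianPi n).map fun x => m + B *ᵥ x := by
  obtain ⟨m, S, rfl⟩ := exists_eq_multivariateGaussian μ
  refine ⟨m.ofLp, CFC.sqrt S, ?_⟩
  rw [multivariateGaussian, ← map_pi_eq_stdGaussian, Measure.map_map (by fun_prop) (by fun_prop),
    Measure.map_map (by fun_prop) (by fun_prop)]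
  rfl

variable {Ω : Type*} [MeasurableSpace Ω] {P : Measure Ω} {𝒢 : Submodule ℝ (Ω → ℝ)}

lemma IsGaussianSpace.hasGaussianLaw_toLp (h𝒢 : IsGaussianSpace P 𝒢) {ι : Type*} [Finite ι]
    {Z : ι → Ω → ℝ} (hZ : ∀ i, Z i ∈ 𝒢) :
    HasGaussianLaw (fun ω => WithLp.toLp 2 (Z · ω)) P := by
  have := Fintype.ofFinite ι
  have hZm : ∀ i, AEMeasurable (Z i) P := fun i => (h𝒢 _ (hZ i)).aemeasurable
  have hmeas : AEMeasurable (fun ω => WithLp.toLp 2 (Z · ω)) P := by fun_prop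
  refine ⟨⟨fun L => ?_⟩⟩
  have hL : (fun ω => L (WithLp.toLp 2 (Z · ω))) =
      ∑ i, L (EuclideanSpace.basisFun ι ℝ i) • Z i := by
    classical
    ext ω
    rw [← (EuclideanSpace.basisFun ι ℝ).sum_repr (WithLp.toLp 2 (Z · ω)), map_sum,
      Finset.sum_apply]
    exact Finset.sum_congr rfl fun i _ => by simp [mul_comm]
  have hLZ : (fun ω => L (WithLp.toLp 2 (Z · ω))) ∈ 𝒢 :=
    hL ▸ Submodule.sum_mem _ fun i _ => Submodule.smul_mem _ _ (hZ i)
  rw [AEMeasurable.map_map_of_aemeasurable (by fun_prop) hmeas, integral_map hmeas (by fun_prop),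
    variance_map (by fun_prop) hmeas]
  exact (h𝒢 _ hLZ).map_eq_gaussianReal

lemma IsGaussianSpace.exists_map_eq (h𝒢 : IsGaussianSpace P 𝒢) {n : ℕ} {Z : Fin n → Ω → ℝ}
    (hZ : ∀ i, Z i ∈ 𝒢) :
    ∃ (m : Fin n → ℝ) (B : Matrix (Fin n) (Fin n) ℝ),
      P.map (fun ω i => Z i ω) = (stdGaussianPi n).map fun x => m + B *ᵥ x := by
  have hlaw := h𝒢.hasGaussianLaw_toLp hZ
  have := hlaw.isGaussian_map
  obtain ⟨m, B, h⟩ := exists_map_ofLp_eq_map_stdGaussianPi (P.map fun ω => WithLp.toLp 2 (Z · ω))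
  rw [AEMeasurable.map_map_of_aemeasurable (by fun_prop) hlaw.aemeasurable] at h
  exact ⟨m, B, h⟩

end GaussianVectors

section AffineSubstitution

open scoped Matrix

lemma totalDegree_bind₁_le {σ τ R : Type*} [CommSemiring R] {f : σ → MvPolynomial τ R} {k : ℕ}
    (hf : ∀ i, (f i).totalDegree ≤ k) (Q : MvPolynomial σ R) :
    (MvPolynomial.bind₁ f Q).totalDegree ≤ Q.totalDegree * k := by
  have hsum : MvPolynomial.bind₁ f Q =
      ∑ s ∈ Q.support, MvPolynomial.C (Q.coeff s) * ∏ i ∈ s.support, f i ^ s i :=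
    MvPolynomial.eval₂_eq _ _ Q
  rw [hsum]
  refine MvPolynomial.totalDegree_finsetSum_le fun s hs => ?_
  calc (MvPolynomial.C (Q.coeff s) * ∏ i ∈ s.support, f i ^ s i).totalDegree
      ≤ (MvPolynomial.C (Q.coeff s)).totalDegree + (∏ i ∈ s.support, f i ^ s i).totalDegree :=
        MvPolynomial.totalDegree_mul _ _
    _ ≤ 0 + ∑ i ∈ s.support, (f i ^ s i).totalDegree :=
        add_le_add (MvPolynomial.totalDegree_C _).le (MvPolynomial.totalDegree_finsetProd _ _)
    _ ≤ ∑ i ∈ s.support, s i * k := by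
        rw [zero_add]
        exact Finset.sum_le_sum fun i _ => (MvPolynomial.totalDegree_pow _ _).trans
          (Nat.mul_le_mul_left _ (hf i))
    _ = (s.sum fun _ e => e) * k := (Finset.sum_mul _ _ _).symm
    _ ≤ Q.totalDegree * k := Nat.mul_le_mul_right k (MvPolynomial.le_totalDegree hs)

lemma exists_mvPolynomial_eval_affine {σ τ R : Type*} [Fintype τ] [CommSemiring R]
    (Q : MvPolynomial σ R) (m : σ → R) (B : Matrix σ τ R) :
    ∃ S : MvPolynomial τ R, S.totalDegree ≤ Q.totalDegree ∧
      ∀ x, MvPolynomial.eval x S = MvPolynomial.eval (m + B *ᵥ x) Q := by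
  let A : σ → MvPolynomial τ R := fun i =>
    MvPolynomial.C (m i) + ∑ j, MvPolynomial.C (B i j) * MvPolynomial.X j
  have hA : ∀ i, (A i).totalDegree ≤ 1 := fun i => by
    refine (MvPolynomial.totalDegree_add _ _).trans (max_le (by simp) ?_)
    refine MvPolynomial.totalDegree_finsetSum_le fun j _ => ?_
    rw [MvPolynomial.C_mul_X_eq_monomial]
    exact (MvPolynomial.totalDegree_monomial_le _ _).trans (by simp)
  refine ⟨MvPolynomial.bind₁ A Q, (totalDegree_bind₁_le hA Q).trans_eq (mul_one _), fun x => ?_⟩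
  have heval : (fun i => MvPolynomial.eval x (A i)) = m + B *ᵥ x := by
    ext i
    simp [A, Matrix.mulVec, dotProduct]
  rw [← heval]
  exact MvPolynomial.eval₂Hom_bind₁ (RingHom.id R) x A Q

end AffineSubstitution

section GaussianPolynomials

lemma integrable_eval_stdGaussianPi {n : ℕ} (Q : MvPolynomial (Fin n) ℝ) :
    Integrable (fun x => MvPolynomial.eval x Q) (stdGaussianPi n) := by
  simp only [MvPolynomial.eval_eq']
  refine integrable_finsetSum _ fun s _ => Integrable.const_mul ?_ _
  refine Integrable.fintype_prod (f := fun i z => z ^ s i) fun i => ?_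
  simpa using integrable_add_const_mul_pow_gaussianReal 0 1 (s i)

lemma enorm_rpow_le_one_add_enorm_pow {p : ℝ} (hp : 0 ≤ p) {k : ℕ} (hpk : p ≤ k) (y : ℝ) :
    ‖y‖ₑ ^ p ≤ 1 + ‖y ^ k‖ₑ := by
  rw [enorm_pow, ← ENNReal.rpow_natCast]
  rcases le_total ‖y‖ₑ 1 with hy | hy
  · exact (ENNReal.rpow_le_one hy hp).trans le_self_add
  · exact (ENNReal.rpow_le_rpow_of_exponent_le hy hpk).trans le_add_self

lemma iSup_rpow_le_sum_rpow {ι : Type*} [Fintype ι] (a : ι → ℝ≥0∞) {p : ℝ} (hp : 0 < p) :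
    (⨆ i, a i) ^ p ≤ ∑ i, a i ^ p := by
  rw [← ENNReal.orderIsoRpow_apply p hp, OrderIso.map_iSup]
  exact iSup_le fun i => Finset.single_le_sum (f := fun i => a i ^ p) (fun _ _ => zero_le)
    (Finset.mem_univ i)

lemma lintegral_iSup_eval_rpow_ne_top {n : ℕ} {ι : Type*} [Finite ι]
    (Q : ι → MvPolynomial (Fin n) ℝ) {p : ℝ} (hp : 0 < p) :
    ∫⁻ x, (⨆ i, ‖MvPolynomial.eval x (Q i)‖ₑ) ^ p ∂stdGaussianPi n ≠ ∞ := by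
  have := Fintype.ofFinite ι
  obtain ⟨k, hk⟩ := exists_nat_ge p
  have hle : ∀ x, (⨆ i, ‖MvPolynomial.eval x (Q i)‖ₑ) ^ p ≤
      ∑ i, (1 + ‖MvPolynomial.eval x (Q i ^ k)‖ₑ) := fun x =>
    (iSup_rpow_le_sum_rpow _ hp).trans <| Finset.sum_le_sum fun i _ =>
      (enorm_rpow_le_one_add_enorm_pow hp.le hk _).trans_eq (by rw [map_pow])
  refine ne_top_of_le_ne_top ?_ (lintegral_mono hle)
  rw [lintegral_finsetSum _ fun i _ =>
    (MvPolynomial.continuous_eval _).measurable.enorm.const_add 1]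
  refine (ENNReal.sum_lt_top.2 fun i _ => ?_).ne
  rw [lintegral_add_left measurable_const, lintegral_const, measure_univ, mul_one]
  exact ENNReal.add_lt_top.2 ⟨ENNReal.one_lt_top,
    hasFiniteIntegral_iff_enorm.1 (integrable_eval_stdGaussianPi (Q i ^ k)).hasFiniteIntegral⟩

lemma momentComparison_iSup_eval {n d : ℕ} {ι : Type*} [Finite ι]
    {Q : ι → MvPolynomial (Fin n) ℝ} (hQ : ∀ i, (Q i).totalDegree ≤ d) :
    MomentComparison (stdGaussianPi n) d fun x => ⨆ i, ‖MvPolynomial.eval x (Q i)‖ₑ := by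
  refine fun p r hp hpr => ⟨eLpNorm_iSup_eval_le hQ hp hpr, ?_⟩
  have hp0 : 0 < p := one_pos.trans hp
  rw [eLpNorm_ennreal_eq_lintegral hp0]
  exact ENNReal.rpow_lt_top_of_nonneg (by positivity) (lintegral_iSup_eval_rpow_ne_top Q hp0)

lemma momentComparison_map_iff {Ω α : Type*} [MeasurableSpace Ω] [MeasurableSpace α]
    {P : Measure Ω} {V : Ω → α} (hV : AEMeasurable V P) {M : α → ℝ≥0∞} (hM : Measurable M)
    {d : ℕ} : MomentComparison (P.map V) d M ↔ MomentComparison P d (M ∘ V) := by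
  simp only [MomentComparison, eLpNorm_map_measure hM.aestronglyMeasurable hV]

lemma exists_common_gaussianVector {Ω : Type*} {𝒢 : Submodule ℝ (Ω → ℝ)} {d : ℕ} {ι : Type*}
    [Finite ι] {Y : ι → Ω → ℝ}
    (hY : ∀ i, Y i ∈ gaussianPolynomials 𝒢 d) :
    ∃ (n : ℕ) (Z : Fin n → Ω → ℝ) (Q : ι → MvPolynomial (Fin n) ℝ), (∀ k, Z k ∈ 𝒢) ∧
      (∀ i, (Q i).totalDegree ≤ d) ∧ ∀ i ω, Y i ω = MvPolynomial.eval (fun k => Z k ω) (Q i) := by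
  choose n Z Q hZ hQ hYQ using hY
  have := Fintype.ofFinite ι
  obtain ⟨e⟩ : Nonempty ((Σ i, Fin (n i)) ≃ Fin (Fintype.card (Σ i, Fin (n i)))) :=
    ⟨Fintype.equivFin _⟩
  refine ⟨_, fun k => Z (e.symm k).1 (e.symm k).2,
    fun i => MvPolynomial.rename (fun j => e ⟨i, j⟩) (Q i), fun k => hZ _ _,
    fun i => (MvPolynomial.totalDegree_rename_le _ _).trans (hQ i), fun i ω => ?_⟩
  have hcomp : (fun k => Z (e.symm k).1 (e.symm k).2 ω) ∘ (fun j => e ⟨i, j⟩) =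
      fun j => Z i j ω := by
    ext j
    simp only [Function.comp_apply]
    rw [e.symm_apply_apply]
  rw [hYQ i, MvPolynomial.eval_rename, hcomp]

variable {Ω : Type*} [MeasurableSpace Ω] {P : Measure Ω} {𝒢 : Submodule ℝ (Ω → ℝ)} {d : ℕ}

lemma IsGaussianSpace.aemeasurable_of_mem_gaussianPolynomials (h𝒢 : IsGaussianSpace P 𝒢)
    {Y : Ω → ℝ} (hY : Y ∈ gaussianPolynomials 𝒢 d) : AEMeasurable Y P := by
  obtain ⟨n, Z, q, hZ, -, rfl⟩ := hY
  exact (MvPolynomial.continuous_eval q).measurable.comp_aemeasurable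
    (aemeasurable_pi_lambda _ fun i => (h𝒢 _ (hZ i)).aemeasurable)

lemma momentComparison_iSup_of_mem_gaussianPolynomials (h𝒢 : IsGaussianSpace P 𝒢) {ι : Type*}
    [Finite ι] {Y : ι → Ω → ℝ} (hY : ∀ i, Y i ∈ gaussianPolynomials 𝒢 d) :
    MomentComparison P d fun ω => ⨆ i, ‖Y i ω‖ₑ := by
  obtain ⟨n, Z, Q, hZ, hQ, hYQ⟩ := exists_common_gaussianVector hY
  obtain ⟨m, B, hlaw⟩ := h𝒢.exists_map_eq hZ
  choose R hRd hR using fun i => exists_mvPolynomial_eval_affine (Q i) m B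
  let M : (Fin n → ℝ) → ℝ≥0∞ := fun z => ⨆ i, ‖MvPolynomial.eval z (Q i)‖ₑ
  have hM : Measurable M := .iSup fun i => (MvPolynomial.continuous_eval (Q i)).measurable.enorm
  have hZm : AEMeasurable (fun ω i => Z i ω) P :=
    aemeasurable_pi_lambda _ fun i => (h𝒢 _ (hZ i)).aemeasurable
  have hB : AEMeasurable (fun x => m + B.mulVec x) (stdGaussianPi n) :=
    (continuous_const.add (continuous_const.matrix_mulVec continuous_id)).aemeasurable
  have hcomp := momentComparison_iSup_eval fun i => (hRd i).trans (hQ i)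
  simp only [hR] at hcomp
  have hMB : MomentComparison (P.map fun ω i => Z i ω) d M := by
    rw [hlaw, momentComparison_map_iff hB hM]
    exact hcomp
  rw [momentComparison_map_iff hZm hM] at hMB
  simp only [hYQ]
  exact hMB

end GaussianPolynomials

section ChaosSuprema

variable {Ω : Type*} [MeasurableSpace Ω] {P : Measure Ω} {𝒢 : Submodule ℝ (Ω → ℝ)} {d : ℕ}

lemma IsGaussianSpace.aemeasurable_of_mem_gaussianChaos (h𝒢 : IsGaussianSpace P 𝒢) {Y : Ω → ℝ}
    (hY : Y ∈ gaussianChaos P 𝒢 d) : AEMeasurable Y P := by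
  obtain ⟨Q, hQ, hlim⟩ := hY
  exact hlim.aemeasurable fun k => h𝒢.aemeasurable_of_mem_gaussianPolynomials (hQ k)

variable [IsProbabilityMeasure P]

lemma momentComparison_iSup_of_mem_gaussianChaos_of_finite (h𝒢 : IsGaussianSpace P 𝒢)
    {ι : Type*} [Finite ι] {Y : ι → Ω → ℝ} (hY : ∀ i, Y i ∈ gaussianChaos P 𝒢 d) :
    MomentComparison P d fun ω => ⨆ i, ‖Y i ω‖ₑ := by
  have := Fintype.ofFinite ι
  choose Q hQ hlim using hY
  choose ns _ hae using fun i => (hlim i).exists_seq_tendsto_ae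
  refine MomentComparison.of_tendsto_ae (Mk := fun k ω => ⨆ i, ‖Q i (ns i k) ω‖ₑ)
    (fun k => .iSup fun i => (h𝒢.aemeasurable_of_mem_gaussianPolynomials (hQ i _)).enorm)
    (fun k => momentComparison_iSup_of_mem_gaussianPolynomials h𝒢 fun i => hQ i _)
    ?_ (ae_of_all _ fun ω => ?_)
  · filter_upwards [ae_all_iff.2 hae] with ω hω
    simp only [← Finset.sup_univ_eq_iSup]
    exact Tendsto.finset_sup_nhds_apply fun i _ => (hω i).enorm
  · rw [← Finset.sup_univ_eq_iSup, Finset.sup_lt_iff ENNReal.zero_lt_top]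
    exact fun i _ => enorm_lt_top

lemma tendsto_iSup_fin_iSup (a : ℕ → ℝ≥0∞) :
    Tendsto (fun n => ⨆ i : Fin n, a i) atTop (𝓝 (⨆ i, a i)) := by
  have hmono : Monotone fun n => ⨆ i : Fin n, a i := fun m n hmn =>
    iSup_le fun i => le_iSup (fun j : Fin n => a j) (Fin.castLE hmn i)
  convert tendsto_atTop_iSup hmono using 2
  refine le_antisymm (iSup_le fun i => ?_)
    (iSup_le fun n => iSup_le fun i => le_iSup a i)
  exact le_iSup_of_le (i + 1) (le_iSup (fun j : Fin (i + 1) => a j) (Fin.last i))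

theorem momentComparison_iSup_of_mem_gaussianChaos (h𝒢 : IsGaussianSpace P 𝒢) {Y : ℕ → Ω → ℝ}
    (hY : ∀ i, Y i ∈ gaussianChaos P 𝒢 d) (hfin : ∀ᵐ ω ∂P, ⨆ i, ‖Y i ω‖ₑ < ∞) :
    MomentComparison P d fun ω => ⨆ i, ‖Y i ω‖ₑ :=
  MomentComparison.of_tendsto_ae (Mk := fun n ω => ⨆ i : Fin n, ‖Y i ω‖ₑ)
    (fun _ => .iSup fun i => (h𝒢.aemeasurable_of_mem_gaussianChaos (hY i)).enorm)
    (fun _ => momentComparison_iSup_of_mem_gaussianChaos_of_finite h𝒢 fun i => hY i)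
    (ae_of_all _ fun _ => tendsto_iSup_fin_iSup _) hfin

end ChaosSuprema

section PseudoSeminorm

variable {F : Type*} [AddCommGroup F] [Module ℝ F] {N : F → ℝ≥0∞}

lemma IsPseudoSeminorm.map_zero (hN : IsPseudoSeminorm N) : N 0 = 0 := by
  simpa using hN.smul 0 0

lemma IsPseudoSeminorm.map_neg (hN : IsPseudoSeminorm N) (x : F) : N (-x) = N x := by
  simpa using hN.smul (-1) x

lemma IsPseudoSeminorm.convex_le (hN : IsPseudoSeminorm N) (c : ℝ≥0∞) :
    Convex ℝ {x | N x ≤ c} := by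
  intro x hx y hy a b ha hb hab
  rw [Set.mem_ofPred_eq] at hx hy ⊢
  calc N (a • x + b • y) ≤ ENNReal.ofReal a * N x + ENNReal.ofReal b * N y := by
        simpa [hN.smul, abs_of_nonneg ha, abs_of_nonneg hb] using hN.add_le (a • x) (b • y)
    _ ≤ ENNReal.ofReal a * c + ENNReal.ofReal b * c := by gcongr
    _ = c := by rw [← add_mul, ← ENNReal.ofReal_add ha hb, hab, ENNReal.ofReal_one, one_mul]

lemma IsPseudoSeminorm.ofReal_apply_le (hN : IsPseudoSeminorm N) {f : F →ₗ[ℝ] ℝ} {t : ℝ}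
    (ht : 0 < t) (hf : ∀ y, N y ≤ ENNReal.ofReal t → f y ≤ t) (y : F) :
    ENNReal.ofReal (f y) ≤ N y := by
  by_contra! hlt
  obtain ⟨c, hNc, hcf⟩ := ENNReal.lt_iff_exists_nnreal_btwn.1 hlt
  have hc : (0 : ℝ) < c := NNReal.coe_pos.2 (ENNReal.coe_pos.1 hNc.pos)
  have hscaled : t / c * f y ≤ t := by
    rw [← smul_eq_mul, ← map_smul]
    refine hf _ ?_
    calc N ((t / c) • y) = ENNReal.ofReal (t / c) * N y := by
          rw [hN.smul, abs_of_pos (by positivity)]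
      _ ≤ ENNReal.ofReal (t / c) * ENNReal.ofReal c := by
          rw [ENNReal.ofReal_coe_nnreal]
          gcongr
      _ = ENNReal.ofReal t := by
          rw [← ENNReal.ofReal_mul (by positivity), div_mul_cancel₀ t hc.ne']
  have hcf' : (c : ℝ) < f y := by
    rwa [← ENNReal.ofReal_coe_nnreal, ENNReal.ofReal_lt_ofReal_iff_of_nonneg c.coe_nonneg] at hcf
  refine hscaled.not_gt ?_
  calc t = t / c * c := (div_mul_cancel₀ t hc.ne').symm
    _ < t / c * f y := by gcongr

lemma IsPseudoSeminorm.enorm_apply_le (hN : IsPseudoSeminorm N) {f : F →ₗ[ℝ] ℝ} {t : ℝ}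
    (ht : 0 < t) (hf : ∀ y, N y ≤ ENNReal.ofReal t → f y ≤ t) (y : F) : ‖f y‖ₑ ≤ N y := by
  rw [Real.enorm_eq_ofReal_abs]
  rcases abs_choice (f y) with h | h
  · rw [h]
    exact hN.ofReal_apply_le ht hf y
  · rw [h, ← _root_.map_neg, ← hN.map_neg]
    exact hN.ofReal_apply_le ht hf (-y)

variable [TopologicalSpace F] [IsTopologicalAddGroup F] [ContinuousSMul ℝ F]
  [LocallyConvexSpace ℝ F]

lemma IsPseudoSeminorm.exists_clm_enorm_le_and_lt_enorm (hN : IsPseudoSeminorm N)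
    (hlsc : LowerSemicontinuous N) {t : ℝ} (ht : 0 < t) {x : F} (hx : ENNReal.ofReal t < N x) :
    ∃ φ : F →L[ℝ] ℝ, (∀ y, ‖φ y‖ₑ ≤ N y) ∧ ENNReal.ofReal t < ‖φ x‖ₑ := by
  obtain ⟨f, u, hfu, hux⟩ := geometric_hahn_banach_closed_point
    (hN.convex_le (ENNReal.ofReal t)) (hlsc.isClosed_preimage _) (not_le.2 hx)
  have hu : 0 < u := by simpa using hfu 0 (by simp [hN.map_zero])
  refine ⟨(t / u) • f, hN.enorm_apply_le (f := ((t / u) • f).toLinearMap) ht fun y hy => ?_, ?_⟩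
  · calc t / u * f y ≤ t / u * u := by gcongr; exact (hfu y hy).le
      _ = t := div_mul_cancel₀ t hu.ne'
  · rw [Real.enorm_eq_ofReal_abs, ENNReal.ofReal_lt_ofReal_iff_of_nonneg ht.le]
    calc t = t / u * u := (div_mul_cancel₀ t hu.ne').symm
      _ < t / u * f x := by gcongr
      _ ≤ |((t / u) • f) x| := le_abs_self _

lemma IsPseudoSeminorm.exists_countable_lt_enorm (hN : IsPseudoSeminorm N)
    (hlsc : LowerSemicontinuous N) {A : Set F} (hA : IsHereditarilyLindelof A) {t : ℝ}
    (ht : 0 < t) :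
    ∃ T : Set (F →L[ℝ] ℝ), T.Countable ∧ (∀ φ ∈ T, ∀ y, ‖φ y‖ₑ ≤ N y) ∧
      ∀ x ∈ A, ENNReal.ofReal t < N x → ∃ φ ∈ T, ENNReal.ofReal t < ‖φ x‖ₑ := by
  have hφ : ∀ x, ENNReal.ofReal t < N x →
      ∃ φ : F →L[ℝ] ℝ, (∀ y, ‖φ y‖ₑ ≤ N y) ∧ ENNReal.ofReal t < ‖φ x‖ₑ :=
    fun x hx => hN.exists_clm_enorm_le_and_lt_enorm hlsc ht hx
  choose! φ hφN hφx using hφ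
  obtain ⟨s, hsc, hs, hcover⟩ :=
    (hA.isLindelof_subset (Set.sep_subset A fun x => ENNReal.ofReal t < N x)).elim_nhds_subcover
      (fun x => {y | ENNReal.ofReal t < ‖φ x y‖ₑ}) fun x hx =>
        (isOpen_lt continuous_const (φ x).continuous.enorm).mem_nhds (hφx x hx.2)
  refine ⟨φ '' s, hsc.image φ, ?_, fun x hxA hx => ?_⟩
  · rintro _ ⟨x, hx, rfl⟩
    exact hφN x (hs x hx).2
  · obtain ⟨z, hz, hlt⟩ := Set.mem_iUnion₂.1 (hcover ⟨hxA, hx⟩)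
    exact ⟨φ z, Set.mem_image_of_mem φ hz, hlt⟩

lemma IsPseudoSeminorm.exists_seq_eq_iSup_enorm (hN : IsPseudoSeminorm N)
    (hlsc : LowerSemicontinuous N) {A : Set F} (hA : IsHereditarilyLindelof A) :
    ∃ φ : ℕ → F →L[ℝ] ℝ, ∀ x ∈ A, N x = ⨆ n, ‖φ n x‖ₑ := by
  choose! T hTc hTN hT using fun (q : ℚ) (hq : (0 : ℝ) < q) =>
    hN.exists_countable_lt_enorm hlsc hA hq
  have hcount : (insert 0 (⋃ q ∈ {q : ℚ | (0 : ℝ) < q}, T q)).Countable :=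
    ((Set.to_countable _).biUnion hTc).insert _
  obtain ⟨φ, hφ⟩ := hcount.exists_eq_range (Set.insert_nonempty _ _)
  refine ⟨φ, fun x hx => le_antisymm (le_of_forall_lt fun a ha => ?_) (iSup_le fun n => ?_)⟩
  · obtain ⟨q, -, haq, hqN⟩ := ENNReal.lt_iff_exists_rat_btwn.1 ha
    have hq : (0 : ℝ) < q := ENNReal.ofReal_pos.1 haq.pos
    obtain ⟨ψ, hψ, hlt⟩ := hT q hq x hx hqN
    obtain ⟨n, rfl⟩ : ψ ∈ Set.range φ :=
      hφ ▸ Set.mem_insert_of_mem _ (Set.mem_biUnion hq hψ)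
    exact (haq.trans hlt).trans_le (le_iSup (fun n => ‖φ n x‖ₑ) n)
  · rcases hφ.symm.subset (Set.mem_range_self n) with hn | hn
    · simp [hn]
    · obtain ⟨q, hq, hn⟩ := Set.mem_iUnion₂.1 hn
      exact hTN q hq _ hn x

lemma isHereditarilyLindelof_of_separable {E : Type*} [TopologicalSpace E]
    (hE : MetrizableSpace E ∨ HereditarilyLindelofSpace E) (A : Set E) [SeparableSpace A] :
    IsHereditarilyLindelof A := by
  intro s hs
  rcases hE with hE | hE
  · let _ := metrizableSpaceMetric E
    have : SecondCountableTopology A := UniformSpace.secondCountable_of_separable A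
    have himage := (HereditarilyLindelofSpace.isLindelof ((↑) ⁻¹' s : Set A)).image
      continuous_subtype_val
    rwa [Subtype.image_preimage_coe, Set.inter_eq_right.2 hs] at himage
  · exact HereditarilyLindelofSpace.isLindelof s

end PseudoSeminorm

section WeakChaos

variable {Ω : Type*} [MeasurableSpace Ω] {P : Measure Ω} {F : Type*} [AddCommGroup F] [Module ℝ F]
  [TopologicalSpace F] [IsTopologicalAddGroup F] [ContinuousSMul ℝ F] [LocallyConvexSpace ℝ F]
  {X : Ω → F} {N : F → ℝ≥0∞} {A : Set F} {𝒢 : Submodule ℝ (Ω → ℝ)} {d : ℕ}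

lemma IsPseudoSeminorm.exists_seq_ae_eq_iSup_enorm (hN : IsPseudoSeminorm N)
    (hlsc : LowerSemicontinuous N) (hA : IsHereditarilyLindelof A) (hXA : ∀ᵐ ω ∂P, X ω ∈ A) :
    ∃ φ : ℕ → F →L[ℝ] ℝ, (fun ω => N (X ω)) =ᵐ[P] fun ω => ⨆ n, ‖φ n (X ω)‖ₑ := by
  obtain ⟨φ, hφ⟩ := hN.exists_seq_eq_iSup_enorm hlsc hA
  exact ⟨φ, hXA.mono fun ω hω => hφ _ hω⟩

lemma IsPseudoSeminorm.aemeasurable_comp (hN : IsPseudoSeminorm N) (hlsc : LowerSemicontinuous N)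
    (hA : IsHereditarilyLindelof A) (hXA : ∀ᵐ ω ∂P, X ω ∈ A)
    (hX : ∀ φ : F →L[ℝ] ℝ, AEMeasurable (fun ω => φ (X ω)) P) :
    AEMeasurable (fun ω => N (X ω)) P := by
  obtain ⟨φ, hφ⟩ := hN.exists_seq_ae_eq_iSup_enorm hlsc hA hXA
  exact (AEMeasurable.iSup fun n => (hX (φ n)).enorm).congr hφ.symm

theorem IsPseudoSeminorm.momentComparison_comp [IsProbabilityMeasure P]
    (hN : IsPseudoSeminorm N) (hlsc : LowerSemicontinuous N) (hA : IsHereditarilyLindelof A)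
    (hXA : ∀ᵐ ω ∂P, X ω ∈ A) (h𝒢 : IsGaussianSpace P 𝒢)
    (hweak : ∀ φ : F →L[ℝ] ℝ, (fun ω => φ (X ω)) ∈ gaussianChaos P 𝒢 d)
    (hfin : ∀ᵐ ω ∂P, N (X ω) < ∞) : MomentComparison P d fun ω => N (X ω) := by
  obtain ⟨φ, hφ⟩ := hN.exists_seq_ae_eq_iSup_enorm hlsc hA hXA
  have hcomp := momentComparison_iSup_of_mem_gaussianChaos h𝒢 (fun n => hweak (φ n))
    (by filter_upwards [hφ, hfin] with ω hω hfinω using hω ▸ hfinω)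
  intro p r hp hpr
  rw [eLpNorm_congr_ae hφ, eLpNorm_congr_ae hφ]
  exact hcomp p r hp hpr

end WeakChaos

section ExponentialMoments

lemma chaosConst_two_le_mul_rpow (d : ℕ) {r : ℝ} (hr : 1 ≤ r) :
    chaosConst d 2 r ≤ 2 ^ ((d : ℝ) ^ 2 / 2 + d) * r ^ ((d : ℝ) / 2) := by
  have hbase : (r - 1) / (2 - 1) = r - 1 := by norm_num
  rw [chaosConst, hbase]
  have : 0 ≤ r - 1 := sub_nonneg.2 hr
  gcongr
  exact sub_le_self r zero_le_one

lemma chaosConst_two_nonneg (d : ℕ) {r : ℝ} (hr : 1 ≤ r) : 0 ≤ chaosConst d 2 r :=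
  mul_nonneg (by positivity) (Real.rpow_nonneg (div_nonneg (sub_nonneg.2 hr) (by norm_num)) _)

lemma chaosConst_two_rpow_le {d k : ℕ} (hd : d ≠ 0) (hdk : d ≤ k) :
    chaosConst d 2 (2 / d * k) ^ (2 / d * k : ℝ) ≤ (2 ^ (d + 3) / d) ^ k * (k : ℝ) ^ k := by
  have hd0 : (0 : ℝ) < d := by positivity
  have hr : 1 ≤ 2 / (d : ℝ) * k := by
    have hdk' : (d : ℝ) ≤ k := by exact_mod_cast hdk
    rw [div_mul_eq_mul_div, le_div_iff₀ hd0]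
    linarith
  calc chaosConst d 2 (2 / d * k) ^ (2 / d * k : ℝ)
      ≤ (2 ^ ((d : ℝ) ^ 2 / 2 + d) * (2 / d * k : ℝ) ^ ((d : ℝ) / 2)) ^ (2 / d * k : ℝ) :=
        Real.rpow_le_rpow (chaosConst_two_nonneg d hr) (chaosConst_two_le_mul_rpow d hr)
          (by positivity)
    _ = 2 ^ (((d : ℝ) ^ 2 / 2 + d) * (2 / d * k)) *
          (2 / d * k : ℝ) ^ ((d : ℝ) / 2 * (2 / d * k)) := by
        rw [Real.mul_rpow (by positivity) (by positivity), ← Real.rpow_mul zero_le_two,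
          ← Real.rpow_mul (by positivity)]
    _ = 2 ^ (((d + 2 : ℕ) : ℝ) * k) * (2 / d * k : ℝ) ^ (k : ℝ) := by
        congr 2 <;> push_cast <;> field_simp
    _ = (2 ^ (d + 3) / d) ^ k * (k : ℝ) ^ k := by
        rw [Real.rpow_mul zero_le_two, Real.rpow_natCast, Real.rpow_natCast, Real.rpow_natCast,
          ← mul_pow, ← mul_pow]
        ring

lemma chaosConst_two_rpow_div_factorial_le {d k : ℕ} (hd : d ≠ 0) (hdk : d ≤ k) :
    chaosConst d 2 (2 / d * k) ^ (2 / d * k : ℝ) / k.factorial ≤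
      (Real.exp 1 * 2 ^ (d + 3) / d) ^ k := by
  have hfac : (k : ℝ) ^ k / k.factorial ≤ Real.exp 1 ^ k := by
    rw [← Real.exp_nat_mul, mul_one]
    exact Real.pow_div_factorial_le_exp _ k.cast_nonneg k
  calc chaosConst d 2 (2 / d * k) ^ (2 / d * k : ℝ) / k.factorial
      ≤ (2 ^ (d + 3) / d) ^ k * (k : ℝ) ^ k / k.factorial := by
        gcongr
        exact chaosConst_two_rpow_le hd hdk
    _ = (2 ^ (d + 3) / d) ^ k * ((k : ℝ) ^ k / k.factorial) := mul_div_assoc _ _ _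
    _ ≤ (2 ^ (d + 3) / d) ^ k * Real.exp 1 ^ k := by gcongr
    _ = (Real.exp 1 * 2 ^ (d + 3) / d) ^ k := by rw [← mul_pow]; ring

lemma ereal_exp_mul_eq_tsum {ε : ℝ} (hε : 0 ≤ ε) {y : ℝ≥0∞} (hy : y ≠ ∞) :
    EReal.exp ((ε : EReal) * (y : EReal)) =
      ∑' k : ℕ, ENNReal.ofReal ε ^ k / (k.factorial : ℝ≥0∞) * y ^ k := by
  lift y to NNReal using hy
  have hs := NormedSpace.expSeries_div_hasSum_exp (𝔸 := ℝ) (ε * y)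
  rw [← Real.exp_eq_exp_ℝ] at hs
  rw [EReal.coe_nnreal_eq_coe_real, ← EReal.coe_mul, EReal.exp_coe, ← hs.tsum_eq,
    ENNReal.ofReal_tsum_of_nonneg (fun k => by positivity) hs.summable]
  refine tsum_congr fun k => ?_
  rw [ENNReal.ofReal_div_of_pos (by positivity), ENNReal.ofReal_natCast, mul_pow,
    ENNReal.ofReal_mul (by positivity), ENNReal.ofReal_pow hε, ENNReal.ofReal_pow y.coe_nonneg,
    ENNReal.ofReal_coe_nnreal]
  exact ENNReal.mul_div_right_comm

variable {Ω : Type*} [MeasurableSpace Ω] {P : Measure Ω} {d : ℕ} {M : Ω → ℝ≥0∞}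

lemma MomentComparison.lintegral_rpow_ne_top [IsProbabilityMeasure P]
    (h : MomentComparison P d M) {s : ℝ} (hs : 0 ≤ s) : ∫⁻ ω, M ω ^ s ∂P ≠ ∞ := by
  have hfin : ∫⁻ ω, M ω ^ (s + 2) ∂P ≠ ∞ :=
    lintegral_rpow_ne_top_of_eLpNorm_lt_top (by positivity)
      (h (s + 2) (s + 3) (by linarith) (by linarith)).2
  refine ne_top_of_le_ne_top (b := ∫⁻ ω, (1 + M ω ^ (s + 2)) ∂P) ?_ (lintegral_mono fun ω => ?_)
  · rw [lintegral_add_left measurable_const, lintegral_const, measure_univ, mul_one]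
    exact ENNReal.add_ne_top.2 ⟨ENNReal.one_ne_top, hfin⟩
  · rcases le_total (M ω) 1 with hM | hM
    · exact (ENNReal.rpow_le_one hM hs).trans le_self_add
    · exact (ENNReal.rpow_le_rpow_of_exponent_le hM (by linarith)).trans le_add_self

lemma MomentComparison.lintegral_rpow_div_factorial_le (h : MomentComparison P d M) (hd : d ≠ 0)
    {k : ℕ} (hk : d < k) :
    (∫⁻ ω, M ω ^ (2 / (d : ℝ) * k) ∂P) / (k.factorial : ℝ≥0∞) ≤
      (ENNReal.ofReal (Real.exp 1) * 2 ^ (d + 3) * eLpNorm M 2 P ^ (2 / (d : ℝ)) / d) ^ k := by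
  have hd0 : (0 : ℝ) < d := by positivity
  have hr : 2 < 2 / (d : ℝ) * k := by
    have hdk : (d : ℝ) < k := by exact_mod_cast hk
    rw [div_mul_eq_mul_div, lt_div_iff₀ hd0]
    linarith
  set r : ℝ := 2 / (d : ℝ) * k with hrk
  have hr0 : 0 < r := two_pos.trans hr
  have hmoment := (eLpNorm_ennreal_le_iff hr0).1 (h 2 r one_lt_two hr).1
  rw [ENNReal.mul_rpow_of_nonneg _ _ hr0.le, ENNReal.ofReal_ofNat,
    ENNReal.ofReal_rpow_of_nonneg (chaosConst_two_nonneg d (one_lt_two.trans hr).le) hr0.le]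
    at hmoment
  calc (∫⁻ ω, M ω ^ r ∂P) / (k.factorial : ℝ≥0∞)
      ≤ ENNReal.ofReal (chaosConst d 2 r ^ r) * eLpNorm M 2 P ^ r / k.factorial := by gcongr
    _ = ENNReal.ofReal (chaosConst d 2 r ^ r / k.factorial) * eLpNorm M 2 P ^ r := by
        rw [ENNReal.ofReal_div_of_pos (by positivity), ENNReal.ofReal_natCast]
        exact ENNReal.mul_div_right_comm
    _ ≤ ENNReal.ofReal ((Real.exp 1 * 2 ^ (d + 3) / d) ^ k) * eLpNorm M 2 P ^ r := by
        gcongr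
        exact chaosConst_two_rpow_div_factorial_le hd hk.le
    _ = (ENNReal.ofReal (Real.exp 1) * 2 ^ (d + 3) / d * eLpNorm M 2 P ^ (2 / (d : ℝ))) ^ k := by
        rw [hrk, ENNReal.rpow_mul, ENNReal.rpow_natCast, ENNReal.ofReal_pow (by positivity),
          ← mul_pow, ENNReal.ofReal_div_of_pos hd0, ENNReal.ofReal_mul (by positivity),
          ENNReal.ofReal_natCast, ENNReal.ofReal_pow zero_le_two, ENNReal.ofReal_ofNat]
    _ = _ := congrArg (· ^ k) ENNReal.mul_div_right_comm.symm

lemma lintegral_exp_mul_lt_top_of_nonpos [IsFiniteMeasure P] {Y : Ω → ℝ≥0∞}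
    (hY : ∀ᵐ ω ∂P, Y ω ≠ ∞) {ε : ℝ} (hε : ε ≤ 0) :
    ∫⁻ ω, EReal.exp ((ε : EReal) * (Y ω : EReal)) ∂P < ∞ := by
  refine (lintegral_mono_ae (g := fun _ => 1) ?_).trans_lt (by simp)
  filter_upwards [hY] with ω hω
  lift Y ω to NNReal using hω with y
  rw [EReal.coe_nnreal_eq_coe_real, ← EReal.coe_mul, EReal.exp_le_one_iff]
  exact_mod_cast mul_nonpos_of_nonpos_of_nonneg hε y.2

lemma lintegral_exp_mul_eq_tsum {Y : Ω → ℝ≥0∞} (hYm : AEMeasurable Y P)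
    (hY : ∀ᵐ ω ∂P, Y ω ≠ ∞) {ε : ℝ} (hε : 0 ≤ ε) :
    ∫⁻ ω, EReal.exp ((ε : EReal) * (Y ω : EReal)) ∂P =
      ∑' k : ℕ, ENNReal.ofReal ε ^ k * ((∫⁻ ω, Y ω ^ k ∂P) / (k.factorial : ℝ≥0∞)) :=
  calc ∫⁻ ω, EReal.exp ((ε : EReal) * (Y ω : EReal)) ∂P
      = ∫⁻ ω, ∑' k : ℕ, ENNReal.ofReal ε ^ k / (k.factorial : ℝ≥0∞) * Y ω ^ k ∂P :=
        lintegral_congr_ae (hY.mono fun ω hω => ereal_exp_mul_eq_tsum hε hω)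
    _ = ∑' k : ℕ, ∫⁻ ω, ENNReal.ofReal ε ^ k / (k.factorial : ℝ≥0∞) * Y ω ^ k ∂P :=
        lintegral_tsum fun k => (hYm.pow_const k).const_mul _
    _ = _ := tsum_congr fun k => by
        rw [lintegral_const_mul'' _ (hYm.pow_const k), ← ENNReal.mul_div_right_comm, mul_div_assoc]

lemma tsum_ne_top_of_le_pow {a : ℕ → ℝ≥0∞} (ha : ∀ k, a k ≠ ∞) {ρ : ℝ≥0∞} (hρ : ρ < 1) {m : ℕ}
    (hle : ∀ k, m ≤ k → a k ≤ ρ ^ k) : ∑' k, a k ≠ ∞ := by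
  have hgeom : ∑' k, ρ ^ k ≠ ∞ := by
    rw [ENNReal.tsum_geometric]
    exact ENNReal.inv_ne_top.2 (tsub_pos_of_lt hρ).ne'
  have htail : ∑' k, a (k + m) ≤ ∑' k, ρ ^ k := ENNReal.tsum_le_tsum fun k =>
    (hle _ le_add_self).trans (pow_le_pow_right_of_le_one' hρ.le le_self_add)
  rw [← ENNReal.summable.sum_add_tsum_nat_add' (k := m)]
  exact ENNReal.add_ne_top.2
    ⟨ENNReal.sum_ne_top.2 fun k _ => ha k, ne_top_of_le_ne_top hgeom htail⟩

theorem MomentComparison.lintegral_exp_lt_top [IsProbabilityMeasure P]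
    (h : MomentComparison P d M) (hd : d ≠ 0) (hM : AEMeasurable M P)
    (hfin : ∀ᵐ ω ∂P, M ω < ∞) {ε : ℝ}
    (hε : ENNReal.ofReal ε < (d : ℝ≥0∞) / (ENNReal.ofReal (Real.exp 1) * 2 ^ (d + 3)
      * eLpNorm M 2 P ^ (2 / (d : ℝ)))) :
    ∫⁻ ω, EReal.exp ((ε : EReal) * ((M ω ^ (2 / (d : ℝ)) : ℝ≥0∞) : EReal)) ∂P < ∞ := by
  have hYfin : ∀ᵐ ω ∂P, M ω ^ (2 / (d : ℝ)) ≠ ∞ :=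
    hfin.mono fun ω hω => ENNReal.rpow_ne_top_of_nonneg (by positivity) hω.ne
  rcases le_or_gt ε 0 with hε0 | hε0
  · exact lintegral_exp_mul_lt_top_of_nonpos hYfin hε0
  have hρ : ENNReal.ofReal ε * (ENNReal.ofReal (Real.exp 1) * 2 ^ (d + 3) *
      eLpNorm M 2 P ^ (2 / (d : ℝ)) / d) < 1 := by
    rw [← mul_div_assoc]
    exact ENNReal.div_lt_of_lt_mul ((ENNReal.mul_lt_of_lt_div hε).trans_eq (one_mul _).symm)
  rw [lintegral_exp_mul_eq_tsum (hM.pow_const _) hYfin hε0.le]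
  simp only [← ENNReal.rpow_mul_natCast]
  refine (tsum_ne_top_of_le_pow (fun k => ?_) hρ (m := d + 1) fun k hk => ?_).lt_top
  · have := h.lintegral_rpow_ne_top (s := 2 / (d : ℝ) * k) (by positivity)
    finiteness
  · rw [mul_pow]
    gcongr
    exact h.lintegral_rpow_div_factorial_le hd hk

end ExponentialMoments

end GaussianChaos

theorem mainTheorem3_general
    {Ω : Type*} [MeasurableSpace Ω] (P : Measure Ω) [IsProbabilityMeasure P]
    {F : Type*} [AddCommGroup F] [Module ℝ F] [TopologicalSpace F] [IsTopologicalAddGroup F]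
    [ContinuousSMul ℝ F] [LocallyConvexSpace ℝ F]
    (d : ℕ) (hd : 1 ≤ d)
    (𝒢 : Submodule ℝ (Ω → ℝ)) (h𝒢 : GaussianChaos.IsGaussianSpace P 𝒢)
    (X : Ω → F) {A : Set F} (hA : IsHereditarilyLindelof A) (hXA : ∀ᵐ ω ∂P, X ω ∈ A)
    (hweak : ∀ φ : F →L[ℝ] ℝ, (fun ω => φ (X ω)) ∈ GaussianChaos.gaussianChaos P 𝒢 d)
    (N : F → ℝ≥0∞) (hN : GaussianChaos.IsPseudoSeminorm N) (hlsc : LowerSemicontinuous N)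
    (hfin : ∀ᵐ ω ∂P, N (X ω) < ∞) :
    (∀ p r : ℝ, 1 < p → p < r →
      eLpNorm (fun ω => N (X ω)) (ENNReal.ofReal r) P
          ≤ ENNReal.ofReal ((2 : ℝ) ^ ((d : ℝ) ^ 2 / 2 + d)
              * ((r - 1) / (p - 1)) ^ ((d : ℝ) / 2))
            * eLpNorm (fun ω => N (X ω)) (ENNReal.ofReal p) P
        ∧ eLpNorm (fun ω => N (X ω)) (ENNReal.ofReal p) P < ∞) ∧
    (∀ ε : ℝ,
      ENNReal.ofReal ε
          < (d : ℝ≥0∞) / (ENNReal.ofReal (Real.exp 1) * 2 ^ (d + 3)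
              * eLpNorm (fun ω => N (X ω)) 2 P ^ (2 / (d : ℝ))) →
        ∫⁻ ω, EReal.exp ((ε : EReal) * ((N (X ω) ^ (2 / (d : ℝ)) : ℝ≥0∞) : EReal)) ∂P < ∞) := by
  have hmoment := hN.momentComparison_comp hlsc hA hXA h𝒢 hweak hfin
  have hmeas := hN.aemeasurable_comp hlsc hA hXA fun φ =>
    h𝒢.aemeasurable_of_mem_gaussianChaos (hweak φ)
  exact ⟨hmoment, fun ε hε => hmoment.lintegral_exp_lt_top (by lia) hmeas hfin hε⟩

theorem mainTheorem3
    {Ω : Type*} [MeasurableSpace Ω] (P : Measure Ω) [IsProbabilityMeasure P]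
    {F : Type*} [AddCommGroup F] [Module ℝ F] [TopologicalSpace F] [IsTopologicalAddGroup F]
    [ContinuousSMul ℝ F] [LocallyConvexSpace ℝ F] [T2Space F]
    [MeasurableSpace F] [BorelSpace F]
    (hF : MetrizableSpace F ∨ HereditarilyLindelofSpace F)
    (d : ℕ) (hd : 1 ≤ d)
    (𝒢 : Submodule ℝ (Ω → ℝ)) (h𝒢 : GaussianChaos.IsGaussianSpace P 𝒢)
    (X : Ω → F) (hX : Measurable X) (hsep : GaussianChaos.AESeparablyValued P X)
    (hweak : ∀ φ : F →L[ℝ] ℝ, (fun ω => φ (X ω)) ∈ GaussianChaos.gaussianChaos P 𝒢 d)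
    (N : F → ℝ≥0∞) (hN : GaussianChaos.IsPseudoSeminorm N) (hlsc : LowerSemicontinuous N)
    (hfin : ∀ᵐ ω ∂P, N (X ω) < ∞) :
    (∀ p r : ℝ, 1 < p → p < r →
      eLpNorm (fun ω => N (X ω)) (ENNReal.ofReal r) P
          ≤ ENNReal.ofReal ((2 : ℝ) ^ ((d : ℝ) ^ 2 / 2 + d)
              * ((r - 1) / (p - 1)) ^ ((d : ℝ) / 2))
            * eLpNorm (fun ω => N (X ω)) (ENNReal.ofReal p) P
        ∧ eLpNorm (fun ω => N (X ω)) (ENNReal.ofReal p) P < ∞) ∧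
    (∀ ε : ℝ,
      ENNReal.ofReal ε
          < (d : ℝ≥0∞) / (ENNReal.ofReal (Real.exp 1) * 2 ^ (d + 5)
              * eLpNorm (fun ω => N (X ω)) 2 P ^ (2 / (d : ℝ))) →
        ∫⁻ ω, EReal.exp ((ε : EReal) * ((N (X ω) ^ (2 / (d : ℝ)) : ℝ≥0∞) : EReal)) ∂P < ∞) := by
  obtain ⟨A, -, hA, hXA⟩ := hsep
  obtain ⟨hmoment, hexp⟩ := mainTheorem3_general P d hd 𝒢 h𝒢 X
    (GaussianChaos.isHereditarilyLindelof_of_separable hF A) hXA hweak N hN hlsc hfin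
  refine ⟨hmoment, fun ε hε => hexp ε (hε.trans_le ?_)⟩
  gcongr
  exacts [one_le_two, Nat.le_succ_of_le (Nat.le_succ _)]
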